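/- Consider three parties, each with $N$ inputs $x,y,z\in\{1,\dots,N\}$ and outcomes $a,b,c\in\{-1,1\}$. The correlation of a behaviour $P(a,b,c|x,y,z)$ is $\gamma_{xyz}=\sum_{a,b,c}abc\,P(a,b,c|x,y,z)$. Let $\mathcal L_{cor}(N)$, $\mathcal Q_{cor}(N)$ and $\mathcal{BL}_{cor}(N)$ be the sets of correlations of the following behaviours. * Local: $P=\sum_\lambda p_\lambda P^\lambda_1(a|x)P^\lambda_2(b|y)P^\lambda_3(c|z)$, a finite mixture of products of conditional probability distributions. * Quantum: $P=\langle\psi|E_{a,x}\otimes F_{b,y}\otimes G_{c,z}|\psi\rangle$, where for each input $(E_{a,x})_a$, $(F_{b,y})_b$, $(G_{c,z})_c$ are POVMs on complex Hilbert spaces $H_1,H_2,H_3$ of any dimension, and $\psi$ is a unit vector of the Hilbert tensor product $H_1\otimes H_2\otimes H_3$. * Bilocal: finite mixtures of behaviours of the forms $Q(a,b|x,y)R(c|z)$, $Q(a,c|x,z)R(b|y)$ and $Q(b,c|y,z)R(a|x)$, where $Q$ and $R$ are arbitrary conditional probability distributions. For a real functional $M=(M_{xyz})$ and a set $\mathcal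 A$ of correlations put $\omega_{\mathcal A}(M)=\sup_{\gamma\in\mathcal A}|\sum_{x,y,z}M_{xyz}\gamma_{xyz}|$ and $LV(\mathcal A_1,\mathcal A_2)=\sup_M\omega_{\mathcal A_1}(M)/\omega_{\mathcal A_2}(M)\in[0,\infty]$, with $0/0=0$ and $t/0=\infty$ for $t>0$. Let $K_G$ be the real Grothendieck constant: the least $K$ such that $|\sum_{i,j}M_{ij}\langle u_i,v_j\rangle|\le K$ for all real matrices $M$ with $|\sum_{i,j} M_{ij}a_ib_j|\le 1$ for all signs $a_i,b_j=\pm1$, and all vectors $u_i,v_j$ in the unit ball of a real Hilbert space. Then for every $N$ the set $\mathcal{BL}_{cor}(N)$ does not change if the bipartite distributions $Q$ are required to be non-signalling, and: 1. $LV(\mathcal Q_{cor}(N),\mathcal{BL}_{cor}(N))\le K_G$; so these violations are bounded uniformly in $N$. 2. $LV(\mathcal{BL}_{cor}(N),\mathcal L_{cor}(N))\le\sqrt{2N}$ and $LV(\mathcal{BL}_{cor}(N),\mathcal Q_{cor}(N))\le\sqrt{2N}$. The order $\sqrt N$ is optimal in both: $LV(\mathcal{BL}_{cor}(N),\mathcal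 Q_{cor}(N))\ge\sqrt N/(4K_G)$ and $LV(\mathcal{BL}_{cor}(N),\mathcal L_{cor}(N))\ge\sqrt N/(4K_G)$. Moreover, for every $N\ge1$ there are $n$ with $N/2<2^n\le N$ and a real Hadamard matrix $(h_{xy})$ of order $2^n$ such that the functional with $M_{xyz}=h_{xy}$ for $x,y\le 2^n$, $z=1$, and $M_{xyz}=0$ otherwise, satisfies $\omega_{\mathcal{BL}_{cor}(N)}(M)/\omega_{\mathcal Q_{cor}(N)}(M)\ge\sqrt N/(4K_G)$. -/

import Mathlib

open scoped ENNReal TensorProduct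

noncomputable section

namespace BellCorrelation

/-! ### Outcomes and conditional probability distributions

Outcomes are elements of `ℤˣ = {1, -1}`; the `N` inputs of each party are the elements of `Fin N`. -/

/-- The outcome `±1` as a real number. -/
def val (a : ℤˣ) : ℝ := ((a : ℤ) : ℝ)

/-- `P x a = P(a|x)` is a conditional probability distribution of one party. -/
def IsCondDist₁ {N : ℕ} (P : Fin N → ℤˣ → ℝ) : Prop :=
  (∀ x a, 0 ≤ P x a) ∧ ∀ x, ∑ a, P x a = 1

/-- `P x y a b = P(a,b|x,y)` is a joint conditional probability distribution of two parties. -/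
def IsCondDist₂ {N : ℕ} (P : Fin N → Fin N → ℤˣ → ℤˣ → ℝ) : Prop :=
  (∀ x y a b, 0 ≤ P x y a b) ∧ ∀ x y, ∑ a, ∑ b, P x y a b = 1

/-- The non-signalling conditions for two parties. -/
def IsNonSignalling {N : ℕ} (P : Fin N → Fin N → ℤˣ → ℤˣ → ℝ) : Prop :=
  (∀ x x' y b, ∑ a, P x y a b = ∑ a, P x' y a b) ∧
    ∀ x y y' a, ∑ b, P x y a b = ∑ b, P x y' a b

/-- A tripartite table `P x y z a b c = P(a,b,c|x,y,z)` with two outcomes. -/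
abbrev Behaviour (N : ℕ) : Type := Fin N → Fin N → Fin N → ℤˣ → ℤˣ → ℤˣ → ℝ

/-- Real three-index tables, used both for correlations `γ` and for Bell functionals `M`. -/
abbrev Table (N : ℕ) : Type := Fin N → Fin N → Fin N → ℝ

/-! ### Local, bilocal and quantum behaviours -/

/-- Fully local behaviours: mixtures over a hidden variable of products of three
one-party conditional distributions. -/
def localSet (N : ℕ) : Set (Behaviour N) :=
  {P | ∃ (n : ℕ) (p : Fin n → ℝ) (P₁ P₂ P₃ : Fin n → Fin N → ℤˣ → ℝ),
    (∀ l, 0 ≤ p l) ∧ ∑ l, p l = 1 ∧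
    (∀ l, IsCondDist₁ (P₁ l)) ∧ (∀ l, IsCondDist₁ (P₂ l)) ∧ (∀ l, IsCondDist₁ (P₃ l)) ∧
    ∀ x y z a b c, P x y z a b c = ∑ l, p l * (P₁ l x a * P₂ l y b * P₃ l z c)}

/-- Bilocal behaviours whose two-party boxes are conditional distributions satisfying `R`:
mixtures, over the three bipartitions `12|3`, `13|2`, `23|1` and a hidden variable, of a product of
a two-party box and a one-party conditional distribution. (A subset of the parties and its
complement give the same bipartition, so the sum over proper nonempty subsets is a sum over these
three.) -/
def bilocalSetOf (N : ℕ) (R : (Fin N → Fin N → ℤˣ → ℤˣ → ℝ) → Prop) : Set (Behaviour N) :=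
  {P | ∃ (n : ℕ) (p₁₂ p₁₃ p₂₃ : Fin n → ℝ)
      (Q₁₂ Q₁₃ Q₂₃ : Fin n → Fin N → Fin N → ℤˣ → ℤˣ → ℝ)
      (P₁ P₂ P₃ : Fin n → Fin N → ℤˣ → ℝ),
    (∀ l, 0 ≤ p₁₂ l) ∧ (∀ l, 0 ≤ p₁₃ l) ∧ (∀ l, 0 ≤ p₂₃ l) ∧
    ∑ l, (p₁₂ l + p₁₃ l + p₂₃ l) = 1 ∧
    (∀ l, IsCondDist₂ (Q₁₂ l) ∧ R (Q₁₂ l)) ∧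
    (∀ l, IsCondDist₂ (Q₁₃ l) ∧ R (Q₁₃ l)) ∧
    (∀ l, IsCondDist₂ (Q₂₃ l) ∧ R (Q₂₃ l)) ∧
    (∀ l, IsCondDist₁ (P₁ l)) ∧ (∀ l, IsCondDist₁ (P₂ l)) ∧ (∀ l, IsCondDist₁ (P₃ l)) ∧
    ∀ x y z a b c, P x y z a b c =
      ∑ l, (p₁₂ l * (Q₁₂ l x y a b * P₃ l z c) + p₁₃ l * (Q₁₃ l x z a c * P₂ l y b) +
        p₂₃ l * (Q₂₃ l y z b c * P₁ l x a))}

/-- General bilocal (Svetlichny) behaviours: no restriction on the two-party boxes. -/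
def bilocalSet (N : ℕ) : Set (Behaviour N) := bilocalSetOf N fun _ => True

/-- Non-signalling bilocal behaviours: the two-party boxes are non-signalling. -/
def nsBilocalSet (N : ℕ) : Set (Behaviour N) := bilocalSetOf N IsNonSignalling

/-- `E x a` is a family of two-outcome measurements (POVMs) on `H`. -/
def IsMeasurement {N : ℕ} {H : Type} [NormedAddCommGroup H] [InnerProductSpace ℂ H]
    (E : Fin N → ℤˣ → H →L[ℂ] H) : Prop :=
  (∀ x a, (E x a).IsPositive) ∧ ∀ x, ∑ a, E x a = 1

/-- The Hilbert space tensor product of three Hilbert spaces. -/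
abbrev HilbertTensor₃ (H₁ H₂ H₃ : Type)
    [NormedAddCommGroup H₁] [InnerProductSpace ℂ H₁] [NormedAddCommGroup H₂]
    [InnerProductSpace ℂ H₂] [NormedAddCommGroup H₃] [InnerProductSpace ℂ H₃] : Type :=
  UniformSpace.Completion (H₁ ⊗[ℂ] (H₂ ⊗[ℂ] H₃))

/-- The bounded operator `A ⊗ B ⊗ C` on the Hilbert space tensor product. -/
def tensorOp {H₁ H₂ H₃ : Type}
    [NormedAddCommGroup H₁] [InnerProductSpace ℂ H₁] [NormedAddCommGroup H₂]
    [InnerProductSpace ℂ H₂] [NormedAddCommGroup H₃] [InnerProductSpace ℂ H₃]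
    (A : H₁ →L[ℂ] H₁) (B : H₂ →L[ℂ] H₂) (C : H₃ →L[ℂ] H₃) :
    HilbertTensor₃ H₁ H₂ H₃ →L[ℂ] HilbertTensor₃ H₁ H₂ H₃ :=
  (TensorProduct.mapL A (TensorProduct.mapL B C)).completion

/-- Quantum behaviours: `P(a,b,c|x,y,z) = ⟨ψ|E¹_{a,x} ⊗ E²_{b,y} ⊗ E³_{c,z}|ψ⟩` for measurements
on three Hilbert spaces of arbitrary dimension and a unit vector `ψ` of their tensor product. -/
def quantumSet (N : ℕ) : Set (Behaviour N) :=
  {P | ∃ (H₁ H₂ H₃ : Type)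
      (_ : NormedAddCommGroup H₁) (_ : InnerProductSpace ℂ H₁) (_ : CompleteSpace H₁)
      (_ : NormedAddCommGroup H₂) (_ : InnerProductSpace ℂ H₂) (_ : CompleteSpace H₂)
      (_ : NormedAddCommGroup H₃) (_ : InnerProductSpace ℂ H₃) (_ : CompleteSpace H₃)
      (E₁ : Fin N → ℤˣ → H₁ →L[ℂ] H₁) (E₂ : Fin N → ℤˣ → H₂ →L[ℂ] H₂)
      (E₃ : Fin N → ℤˣ → H₃ →L[ℂ] H₃) (ψ : HilbertTensor₃ H₁ H₂ H₃),
    IsMeasurement E₁ ∧ IsMeasurement E₂ ∧ IsMeasurement E₃ ∧ ‖ψ‖ = 1 ∧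
    ∀ x y z a b c,
      ((P x y z a b c : ℝ) : ℂ) = inner ℂ ψ (tensorOp (E₁ x a) (E₂ y b) (E₃ z c) ψ)}

/-! ### Correlations -/

/-- The correlation `γ_{xyz} = E[abc|x,y,z]` of a behaviour. -/
def correlation {N : ℕ} (P : Behaviour N) : Table N := fun x y z =>
  ∑ a, ∑ b, ∑ c, val a * val b * val c * P x y z a b c

/-- Local correlations. -/
def Lcor (N : ℕ) : Set (Table N) := correlation '' localSet N

/-- Quantum correlations. -/
def Qcor (N : ℕ) : Set (Table N) := correlation '' quantumSet N

/-- General bilocal correlations. -/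
def BLcor (N : ℕ) : Set (Table N) := correlation '' bilocalSet N

/-- Non-signalling bilocal correlations. -/
def nsBLcor (N : ℕ) : Set (Table N) := correlation '' nsBilocalSet N

/-! ### Bell functionals and the largest violation -/

/-- The pairing `⟨M, γ⟩` of a Bell functional and a correlation. -/
def pairing {N : ℕ} (M γ : Table N) : ℝ := ∑ x, ∑ y, ∑ z, M x y z * γ x y z

/-- `ω_A(M) = sup_{γ ∈ A} |⟨M, γ⟩|`, as an extended nonnegative real. -/
def omega {N : ℕ} (A : Set (Table N)) (M : Table N) : ℝ≥0∞ :=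
  ⨆ γ ∈ A, ENNReal.ofReal |pairing M γ|

/-- The largest violation `LV(A₁, A₂) = sup_M ω_{A₁}(M) / ω_{A₂}(M)`. In `ℝ≥0∞` we have `0 / 0 = 0`
and `t / 0 = ∞` for `t ≠ 0`. -/
def LV {N : ℕ} (A₁ A₂ : Set (Table N)) : ℝ≥0∞ := ⨆ M : Table N, omega A₁ M / omega A₂ M

/-! ### Grothendieck's constant -/

/-- `K` satisfies the real Grothendieck inequality: for every real matrix `M` with
`|∑ M_{ij} a_i b_j| ≤ 1` for all signs `a_i`, `b_j`, one has `|∑ M_{ij} ⟨u_i, v_j⟩| ≤ K` for all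
vectors `u_i`, `v_j` in the unit ball of a real Hilbert space. -/
def IsGrothendieckBound (K : ℝ) : Prop :=
  ∀ (m n : ℕ) (M : Fin m → Fin n → ℝ),
    (∀ (a : Fin m → ℤˣ) (b : Fin n → ℤˣ), |∑ i, ∑ j, M i j * (val (a i) * val (b j))| ≤ 1) →
    ∀ (H : Type) [NormedAddCommGroup H] [InnerProductSpace ℝ H] [CompleteSpace H]
      (u : Fin m → H) (v : Fin n → H), (∀ i, ‖u i‖ ≤ 1) → (∀ j, ‖v j‖ ≤ 1) →
      |∑ i, ∑ j, M i j * inner ℝ (u i) (v j)| ≤ K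

/-- The real Grothendieck constant: the best constant in the real Grothendieck inequality. -/
def grothendieckConstant : ℝ := sInf {K : ℝ | IsGrothendieckBound K}

/-! ### Functionals given by a matrix -/

/-- The functional with `M_{xyz} = h_{xy}` when `x, y` are among the first `d` inputs and `z` is the
first input, and `M_{xyz} = 0` otherwise. -/
def matrixFunctional (N : ℕ) {d : ℕ} (h : Matrix (Fin d) (Fin d) ℝ) : Table N := fun x y z =>
  if hxy : (x : ℕ) < d ∧ (y : ℕ) < d then
    if (z : ℕ) = 0 then h ⟨x, hxy.1⟩ ⟨y, hxy.2⟩ else 0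
  else 0

end BellCorrelation

end

namespace BellCorrelation

/-! ### Signs -/

/-! A correlation sees a two-party box only through its expected product. Any table `q` with entries
in `[-1, 1]` is the correlation of a box with uniform marginals, which is non-signalling. So bilocal
correlations are the mixtures of `q x y * r z` and its two permuted forms, with `|q|, |r| ≤ 1`, and
requiring non-signalling changes nothing.

Quantum against bilocal: a quantum correlation is `⟨u x y, v z⟩` for vectors in a unit ball. Reading
`M` as a matrix with rows `(x, y)` and columns `z`, its values on signs are bilocal values, and
Grothendieck's inequality gives `K_G` (`omega_Qcor_le`). Since `K_G` is a real infimum, it must be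
shown that some bound exists; truncated Rademacher sums give `8` (`isGrothendieckBound_eight`).

Bilocal against local: for fixed `r`, the best `q` turns the value into the entrywise ℓ₁ norm of `T
x y = ∑ z, M x y z * r z`. By Littlewood's argument this is at most `√(2N)` times the norm of `T` on
signs (`sum_abs_le_sqrt_mul`): Cauchy–Schwarz costs `√N`, and Khintchine with its best constant
costs `√2`. Local values are at most quantum values, so the same bound holds against quantum.

Optimality: a Hadamard matrix of order `d` has bilocal value at least `d²`, while orthogonality of
its rows bounds the quantum value by `d√d`. With `d > N/2` the ratio `√d` suffices. -/

lemma val_one : val 1 = 1 := by simp [val]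

lemma val_neg (a : ℤˣ) : val (-a) = -val a := by simp [val]

lemma val_eq_or (a : ℤˣ) : val a = 1 ∨ val a = -1 := by
  rcases Int.units_eq_one_or a with rfl | rfl <;> simp [val]

lemma val_mul_self (a : ℤˣ) : val a * val a = 1 := by
  rcases val_eq_or a with h | h <;> simp [h]

lemma abs_val (a : ℤˣ) : |val a| = 1 := by
  rcases val_eq_or a with h | h <;> simp [h]

lemma sum_sign {M : Type*} [AddCommMonoid M] (f : ℤˣ → M) : ∑ a, f a = f 1 + f (-1) := by
  have : (Finset.univ : Finset ℤˣ) = {1, -1} := by decide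
  rw [this, Finset.sum_pair (by decide)]

/-- A sign `a` with `a t = |t|`. -/
noncomputable def signOf (t : ℝ) : ℤˣ := if 0 ≤ t then 1 else -1

lemma val_signOf_mul (t : ℝ) : val (signOf t) * t = |t| := by
  unfold signOf
  split_ifs with h
  · simp [val_one, abs_of_nonneg h]
  · simp [val_neg, val_one, abs_of_neg (not_le.mp h)]

/-! ### Sums over the cube of signs -/

section Cube

variable {ι : Type*} [DecidableEq ι]

/-- The map changing the sign of the `k`-th coordinate. -/
def flip (k : ι) (ε : ι → ℤˣ) : ι → ℤˣ := Pi.mulSingle k (-1) * ε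

lemma val_flip_self (k : ι) (ε : ι → ℤˣ) : val (flip k ε k) = -val (ε k) := by
  simp [flip, val_neg]

lemma val_flip_of_ne {k l : ι} (h : l ≠ k) (ε : ι → ℤˣ) : val (flip k ε l) = val (ε l) := by
  simp [flip, h]

lemma flip_flip (i : ι) (ε : ι → ℤˣ) : flip i (flip i ε) = ε := by
  rw [flip, flip, ← mul_assoc, ← Pi.mulSingle_mul]
  simp

/-- The Walsh functions. -/
def walsh (S : Finset ι) (ε : ι → ℤˣ) : ℝ := ∏ i ∈ S, val (ε i)

lemma walsh_flip (i : ι) (S : Finset ι) (ε : ι → ℤˣ) :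
    walsh S (flip i ε) = (if i ∈ S then -1 else 1) * walsh S ε := by
  unfold walsh
  split_ifs with h
  · rw [← Finset.mul_prod_erase _ _ h, ← Finset.mul_prod_erase S (fun j => val (ε j)) h,
      val_flip_self, Finset.prod_congr rfl fun j hj => val_flip_of_ne (Finset.ne_of_mem_erase hj) ε]
    ring
  · rw [one_mul]
    exact Finset.prod_congr rfl fun j hj => val_flip_of_ne (ne_of_mem_of_not_mem hj h) ε

variable [Fintype ι]

lemma sum_flip (k : ι) (F : (ι → ℤˣ) → ℝ) : ∑ ε, F (flip k ε) = ∑ ε, F ε :=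
  Equiv.sum_comp (Equiv.mulLeft (Pi.mulSingle k (-1) : ι → ℤˣ)) F

lemma sum_val_mul_val (k l : ι) :
    ∑ ε : ι → ℤˣ, val (ε k) * val (ε l) = if k = l then (Fintype.card (ι → ℤˣ) : ℝ) else 0 := by
  split_ifs with h
  · subst h
    simp [val_mul_self]
  · have := sum_flip k fun ε => val (ε k) * val (ε l)
    simp only [val_flip_self, val_flip_of_ne (Ne.symm h), neg_mul, Finset.sum_neg_distrib] at this
    linarith

/-- Orthogonality of the Rademacher functions. -/
lemma sum_rademacher_mul (a b : ι → ℝ) :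
    ∑ ε : ι → ℤˣ, (∑ k, a k * val (ε k)) * (∑ k, b k * val (ε k)) =
      Fintype.card (ι → ℤˣ) * ∑ k, a k * b k := by
  have : ∀ ε : ι → ℤˣ, (∑ k, a k * val (ε k)) * (∑ k, b k * val (ε k)) =
      ∑ k, ∑ l, a k * b l * (val (ε k) * val (ε l)) := fun ε => by
    rw [Finset.sum_mul_sum]
    exact Finset.sum_congr rfl fun k _ => Finset.sum_congr rfl fun l _ => by ring
  simp only [this]
  rw [Finset.sum_comm]
  simp only [Finset.sum_comm (s := (Finset.univ : Finset (ι → ℤˣ)))]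
  simp only [← Finset.mul_sum, sum_val_mul_val, mul_ite, mul_zero, Finset.sum_ite_eq,
    Finset.mem_univ, if_true]
  rw [Finset.mul_sum]
  exact Finset.sum_congr rfl fun k _ => by ring

lemma sum_rademacher_sq_finset (a : ι → ℝ) (s : Finset ι) :
    ∑ ε : ι → ℤˣ, (∑ k ∈ s, a k * val (ε k)) ^ 2 =
      Fintype.card (ι → ℤˣ) * ∑ k ∈ s, a k ^ 2 := by
  have := sum_rademacher_mul (fun k => if k ∈ s then a k else 0) (fun k => if k ∈ s then a k else 0)
  simpa [ite_mul, Finset.sum_ite_mem, ← pow_two, ite_pow] using this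

/-- The fourth moment of a Rademacher sum. -/
lemma sum_rademacher_pow_four_le (a : ι → ℝ) (s : Finset ι) :
    ∑ ε : ι → ℤˣ, (∑ k ∈ s, a k * val (ε k)) ^ 4 ≤
      Fintype.card (ι → ℤˣ) * (3 * (∑ k ∈ s, a k ^ 2) ^ 2) := by
  induction s using Finset.induction_on with
  | empty => simp
  | insert k s hk ih =>
    -- Averaging with the flip of the new coordinate `k` cancels the odd powers of `a k`.
    have h1 : ∑ ε : ι → ℤˣ, (∑ l ∈ insert k s, a l * val (ε l)) ^ 4 =
        ∑ ε : ι → ℤˣ, ((∑ l ∈ s, a l * val (ε l)) ^ 4 +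
          6 * a k ^ 2 * (∑ l ∈ s, a l * val (ε l)) ^ 2 + a k ^ 4) := by
      have h2 := sum_flip k fun ε => (∑ l ∈ insert k s, a l * val (ε l)) ^ 4
      have h3 : ∀ ε : ι → ℤˣ, ∑ l ∈ s, a l * val (flip k ε l) = ∑ l ∈ s, a l * val (ε l) :=
        fun ε => Finset.sum_congr rfl fun l hl => by
          rw [val_flip_of_ne (ne_of_mem_of_not_mem hl hk)]
      simp only [Finset.sum_insert hk, val_flip_self, h3] at h2 ⊢
      rw [← mul_right_inj' (two_ne_zero (α := ℝ)), two_mul]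
      nth_rewrite 1 [← h2]
      rw [← Finset.sum_add_distrib, Finset.mul_sum]
      refine Finset.sum_congr rfl fun ε _ => ?_
      rcases val_eq_or (ε k) with h | h <;> rw [h] <;> ring
    rw [h1, Finset.sum_add_distrib, Finset.sum_add_distrib, ← Finset.mul_sum,
      sum_rademacher_sq_finset, Finset.sum_insert hk, Finset.sum_const, Finset.card_univ,
      nsmul_eq_mul]
    have hW : (0 : ℝ) ≤ Fintype.card (ι → ℤˣ) := by positivity
    have : 0 ≤ (Fintype.card (ι → ℤˣ) : ℝ) * a k ^ 4 := by positivity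
    nlinarith

/-! ### Fourier analysis on the cube and Khintchine's inequality -/

/-- The sum over `S` expands the product of the factors `1 + x i * y i`; a coordinate where `x` and
`y` differ makes its factor zero. -/
lemma sum_walsh_mul_walsh (x y : ι → ℤˣ) :
    ∑ S : Finset ι, walsh S x * walsh S y = if x = y then (Fintype.card (ι → ℤˣ) : ℝ) else 0 := by
  have h := Finset.prod_one_add (s := (Finset.univ : Finset ι))
    (f := fun i => val (x i) * val (y i))
  rw [Finset.powerset_univ] at h
  simp only [walsh, ← Finset.prod_mul_distrib]
  rw [← h]
  split_ifs with hxy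
  · subst hxy
    have h2 : Fintype.card ℤˣ = 2 := by decide
    simp [val_mul_self, one_add_one_eq_two, h2]
  · obtain ⟨i, hi⟩ := Function.ne_iff.mp hxy
    refine Finset.prod_eq_zero (Finset.mem_univ i) ?_
    rcases Int.units_eq_one_or (x i) with h | h <;>
      rcases Int.units_eq_one_or (y i) with h' | h' <;>
      simp_all [val_neg, val_one]

/-- The (unnormalised) Fourier coefficients of a function on the cube. -/
def fourier (f : (ι → ℤˣ) → ℝ) (S : Finset ι) : ℝ := ∑ ε, f ε * walsh S ε

/-- Parseval's identity; the factor `2 ^ |ι|` comes from the missing normalisation. -/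
lemma sum_fourier_mul_fourier (f g : (ι → ℤˣ) → ℝ) :
    ∑ S, fourier f S * fourier g S = Fintype.card (ι → ℤˣ) * ∑ ε, f ε * g ε := by
  have : ∀ S : Finset ι, fourier f S * fourier g S =
      ∑ x, ∑ y, f x * g y * (walsh S x * walsh S y) := fun S => by
    rw [fourier, fourier, Finset.sum_mul_sum]
    exact Finset.sum_congr rfl fun k _ => Finset.sum_congr rfl fun l _ => by ring
  simp only [this]
  rw [Finset.sum_comm, Finset.mul_sum]
  refine Finset.sum_congr rfl fun x _ => ?_
  rw [Finset.sum_comm]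
  simp only [← Finset.mul_sum, sum_walsh_mul_walsh, mul_ite, mul_zero, Finset.sum_ite_eq,
    Finset.mem_univ, if_true]
  ring

/-- The Walsh functions diagonalise the Laplacian of the cube: flipping `i` changes the sign of
`walsh S` exactly when `i ∈ S`, so the eigenvalue is `2|S|`. -/
lemma fourier_sum_sub_flip (f : (ι → ℤˣ) → ℝ) (S : Finset ι) :
    fourier (fun ε => ∑ i, (f ε - f (flip i ε))) S = 2 * S.card * fourier f S := by
  have h : ∀ i, ∑ ε, f (flip i ε) * walsh S ε = (if i ∈ S then -1 else 1) * fourier f S := by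
    intro i
    rw [← sum_flip i, fourier, Finset.mul_sum]
    refine Finset.sum_congr rfl fun ε _ => ?_
    rw [flip_flip, walsh_flip]
    ring
  have h' : ∀ i, ∑ ε, (f ε - f (flip i ε)) * walsh S ε =
      if i ∈ S then 2 * fourier f S else 0 := by
    intro i
    simp only [sub_mul, Finset.sum_sub_distrib, h]
    split_ifs <;> (simp [fourier]; try ring)
  simp only [fourier, Finset.sum_mul]
  rw [Finset.sum_comm]
  simp only [h', Finset.sum_ite_mem, Finset.univ_inter, Finset.sum_const, nsmul_eq_mul]
  simp only [fourier]
  ring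

lemma fourier_singleton_of_even {f : (ι → ℤˣ) → ℝ} (hf : ∀ ε, f (-ε) = f ε) (i : ι) :
    fourier f {i} = 0 := by
  have h := Equiv.sum_comp (Equiv.neg (ι → ℤˣ)) fun ε => f ε * val (ε i)
  simp only [Equiv.neg_apply, hf, Pi.neg_apply, val_neg, mul_neg, Finset.sum_neg_distrib] at h
  simp only [fourier, walsh, Finset.prod_singleton]
  linarith

/-- The spectral gap of the cube on even functions. -/
lemma poincare_of_even {f : (ι → ℤˣ) → ℝ} (hf : ∀ ε, f (-ε) = f ε) :
    4 * (Fintype.card (ι → ℤˣ) * ∑ ε, f ε ^ 2 - (∑ ε, f ε) ^ 2) ≤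
      Fintype.card (ι → ℤˣ) * ∑ ε, f ε * ∑ i, (f ε - f (flip i ε)) := by
  have h1 := sum_fourier_mul_fourier f f
  have h2 := sum_fourier_mul_fourier f fun ε => ∑ i, (f ε - f (flip i ε))
  have h0 : fourier f ∅ = ∑ ε, f ε := by simp [fourier, walsh]
  simp only [fourier_sum_sub_flip] at h2
  simp only [pow_two (f _)]
  rw [← h2, ← h1, ← h0, ← Finset.add_sum_erase Finset.univ _ (Finset.mem_univ ∅),
    ← Finset.add_sum_erase Finset.univ (fun S => fourier f S * (2 * _ * fourier f S))
      (Finset.mem_univ ∅)]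
  -- The set `∅` carries the squared mean. Evenness kills the singletons, so every remaining
  -- eigenvalue is at least `4` instead of `2`.
  have : 4 * ∑ S ∈ Finset.univ.erase ∅, fourier f S * fourier f S ≤
      ∑ S ∈ Finset.univ.erase ∅, fourier f S * (2 * S.card * fourier f S) := by
    rw [Finset.mul_sum]
    refine Finset.sum_le_sum fun S hS => ?_
    have hS : S.Nonempty := Finset.nonempty_iff_ne_empty.mpr (Finset.ne_of_mem_erase hS)
    rcases Nat.lt_or_ge S.card 2 with h | h
    · obtain ⟨i, rfl⟩ := Finset.card_eq_one.mp (le_antisymm (by lia) hS.card_pos)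
      simp [fourier_singleton_of_even hf]
    · have : (2 : ℝ) ≤ S.card := by exact_mod_cast h
      nlinarith [mul_self_nonneg (fourier f S)]
  simp only [Finset.card_empty, Nat.cast_zero]
  nlinarith

/-- Khintchine's inequality between the first and the second moment, with the best constant. -/
lemma khintchine (a : ι → ℝ) :
    (Fintype.card (ι → ℤˣ) : ℝ) * √(∑ k, a k ^ 2) ≤
      √2 * ∑ ε : ι → ℤˣ, |∑ k, a k * val (ε k)| := by
  set f : (ι → ℤˣ) → ℝ := fun ε => |∑ k, a k * val (ε k)| with hf
  set W : ℝ := (Fintype.card (ι → ℤˣ) : ℝ) with hW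
  have hW0 : 0 ≤ W := by positivity
  have heven : ∀ ε, f (-ε) = f ε := fun ε => by
    simp [hf, val_neg, abs_neg]
  -- The flipped sums add up to `|ι| - 2` times the original sum. The triangle inequality then
  -- bounds the Laplacian of `f` pointwise by `2 * f`.
  have hflip : ∀ ε, ∑ i, (f ε - f (flip i ε)) ≤ 2 * f ε := by
    intro ε
    have h1 : ∀ i, ∑ k, a k * val (flip i ε k) = ∑ k, a k * val (ε k) - 2 * (a i * val (ε i)) := by
      intro i
      rw [← Finset.add_sum_erase _ _ (Finset.mem_univ i),
        ← Finset.add_sum_erase _ (fun k => a k * val (ε k)) (Finset.mem_univ i), val_flip_self,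
        Finset.sum_congr rfl fun j hj => by rw [val_flip_of_ne (Finset.ne_of_mem_erase hj)]]
      ring
    have h2 : |∑ i, ∑ k, a k * val (flip i ε k)| ≤ ∑ i, f (flip i ε) :=
      Finset.abs_sum_le_sum_abs _ _
    have h3 : ∑ i, ∑ k, a k * val (flip i ε k) =
        ((Fintype.card ι : ℝ) - 2) * ∑ k, a k * val (ε k) := by
      simp only [h1, Finset.sum_sub_distrib, ← Finset.mul_sum, Finset.sum_const, Finset.card_univ,
        nsmul_eq_mul]
      ring
    rw [h3, abs_mul] at h2
    have h4 : ((Fintype.card ι : ℝ) - 2) * f ε ≤ |(Fintype.card ι : ℝ) - 2| * f ε :=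
      mul_le_mul_of_nonneg_right (le_abs_self _) (abs_nonneg _)
    rw [Finset.sum_sub_distrib, Finset.sum_const, Finset.card_univ, nsmul_eq_mul]
    have h5 := h4.trans h2
    linarith
  -- The spectral gap `4` against the upper bound `2` leaves `W * ∑ f² ≤ 2 * (∑ f)²`, whence the
  -- constant `√2`.
  have h1 := poincare_of_even heven
  have h2 : ∑ ε, f ε * ∑ i, (f ε - f (flip i ε)) ≤ 2 * ∑ ε, f ε ^ 2 := by
    rw [Finset.mul_sum]
    refine Finset.sum_le_sum fun ε _ => ?_
    nlinarith [mul_le_mul_of_nonneg_left (hflip ε) (abs_nonneg _ : 0 ≤ f ε)]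
  have h3 : ∑ ε, f ε ^ 2 = W * ∑ k, a k ^ 2 := by
    simp only [hf, sq_abs]
    exact sum_rademacher_sq_finset a Finset.univ
  have hpos : 0 ≤ ∑ ε, f ε := Finset.sum_nonneg fun ε _ => abs_nonneg _
  refine (pow_le_pow_iff_left₀ (by positivity) (by positivity) two_ne_zero).mp ?_
  rw [mul_pow, mul_pow, Real.sq_sqrt (by positivity), Real.sq_sqrt (by positivity)]
  have h4 := mul_le_mul_of_nonneg_left h2 hW0
  rw [h3] at h1 h4
  nlinarith

end Cube

/-! ### Bilinear forms on signs -/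

section Bilinear

variable {m n : Type*} [Fintype m] [Fintype n] {M : m → n → ℝ}

lemma abs_sum_mul_le {a : m → ℝ} (ha : ∀ i, |a i| ≤ 1) (t : m → ℝ) :
    |∑ i, t i * a i| ≤ ∑ i, |t i| := by
  refine (Finset.abs_sum_le_sum_abs _ _).trans (Finset.sum_le_sum fun i _ => ?_)
  rw [abs_mul]
  exact mul_le_of_le_one_right (abs_nonneg _) (ha i)

lemma sum_abs_le_of_sign_bound {C : ℝ} (t : m → ℝ)
    (h : ∀ s : m → ℤˣ, |∑ i, t i * val (s i)| ≤ C) : ∑ i, |t i| ≤ C := by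
  refine le_trans (le_of_eq ?_) ((le_abs_self _).trans (h fun i => signOf (t i)))
  exact Finset.sum_congr rfl fun i _ => by rw [mul_comm, val_signOf_mul]

/-- A bound on signs for a bilinear form extends to coefficients in `[-1, 1]`. -/
lemma bilinear_le_of_sign_bound {C : ℝ}
    (h : ∀ (a : m → ℤˣ) (b : n → ℤˣ), |∑ i, ∑ j, M i j * (val (a i) * val (b j))| ≤ C)
    {a : m → ℝ} {b : n → ℝ} (ha : ∀ i, |a i| ≤ 1) (hb : ∀ j, |b j| ≤ 1) :
    |∑ i, ∑ j, M i j * (a i * b j)| ≤ C := by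
  have e1 : ∀ (a : m → ℝ) (b : n → ℝ),
      ∑ i, ∑ j, M i j * (a i * b j) = ∑ i, (∑ j, M i j * b j) * a i := fun a b => by
    simp only [Finset.sum_mul]
    exact Finset.sum_congr rfl fun i _ => Finset.sum_congr rfl fun j _ => by ring
  have e2 : ∀ (a : m → ℝ) (b : n → ℝ),
      ∑ i, ∑ j, M i j * (a i * b j) = ∑ j, (∑ i, M i j * a i) * b j := fun a b => by
    rw [Finset.sum_comm]
    simp only [Finset.sum_mul]
    exact Finset.sum_congr rfl fun i _ => Finset.sum_congr rfl fun j _ => by ring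
  rw [e1]
  refine (abs_sum_mul_le ha _).trans (sum_abs_le_of_sign_bound _ fun s => ?_)
  rw [← e1 (fun i => val (s i)), e2 fun i => val (s i)]
  refine (abs_sum_mul_le hb _).trans (sum_abs_le_of_sign_bound _ fun s' => ?_)
  rw [← e2 (fun i => val (s i)) fun j => val (s' j)]
  exact h s s'

end Bilinear

/-! ### The real Grothendieck inequality -/

/-- Truncation at level `2`. -/
noncomputable def clip (t : ℝ) : ℝ := max (-2) (min 2 t)

lemma abs_clip_le_two (t : ℝ) : |clip t| ≤ 2 :=
  abs_le.mpr ⟨le_max_left _ _, max_le (by norm_num) (min_le_left _ _)⟩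

lemma clip_sq_le (t : ℝ) : clip t ^ 2 ≤ t ^ 2 := by
  unfold clip
  rcases le_total 2 t with h | h
  · rw [min_eq_left h, max_eq_right (by norm_num)]
    nlinarith
  · rw [min_eq_right h]
    rcases le_total (-2) t with h' | h'
    · rw [max_eq_right h']
    · rw [max_eq_left h']
      nlinarith

/-- Beyond the truncation level, `|t| - 2 ≤ t² / 8` because `(|t| - 4)² ≥ 0`. The tail is thus
controlled by the fourth moment. -/
lemma sub_clip_sq_le (t : ℝ) : (t - clip t) ^ 2 ≤ t ^ 4 / 64 := by
  have key : |t - clip t| ≤ t ^ 2 / 8 := by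
    unfold clip
    rcases le_total 2 t with h | h
    · rw [min_eq_left h, max_eq_right (by norm_num), abs_of_nonneg (by linarith)]
      nlinarith [sq_nonneg (t - 4)]
    · rw [min_eq_right h]
      rcases le_total (-2) t with h' | h'
      · rw [max_eq_right h', sub_self, abs_zero]
        positivity
      · rw [max_eq_left h', abs_of_nonpos (by linarith)]
        nlinarith [sq_nonneg (t + 4)]
  calc (t - clip t) ^ 2 = |t - clip t| ^ 2 := (sq_abs _).symm
    _ ≤ (t ^ 2 / 8) ^ 2 := pow_le_pow_left₀ (abs_nonneg _) key 2
    _ = t ^ 4 / 64 := by ring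

section Grothendieck

variable {m n : ℕ} {M : Fin m → Fin n → ℝ}

/-- `B` bounds the values of `M` on unit vectors of the Euclidean spaces. -/
def IsVectorBound (M : Fin m → Fin n → ℝ) (B : ℝ) : Prop :=
  ∀ (ι : Type) [Fintype ι] (u : Fin m → ι → ℝ) (v : Fin n → ι → ℝ),
    (∀ i, ∑ k, u i k ^ 2 ≤ 1) → (∀ j, ∑ k, v j k ^ 2 ≤ 1) →
    |∑ i, ∑ j, M i j * ∑ k, u i k * v j k| ≤ B

lemma IsVectorBound.nonneg {B : ℝ} (h : IsVectorBound M B) : 0 ≤ B :=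
  (abs_nonneg _).trans (h Empty (fun _ _ => 0) (fun _ _ => 0) (by simp) (by simp))

lemma IsVectorBound.scale {B : ℝ} (h : IsVectorBound M B) {ι : Type} [Fintype ι]
    {u : Fin m → ι → ℝ} {v : Fin n → ι → ℝ} {s t : ℝ} (hs : 0 < s) (ht : 0 < t)
    (hu : ∀ i, ∑ k, u i k ^ 2 ≤ s ^ 2) (hv : ∀ j, ∑ k, v j k ^ 2 ≤ t ^ 2) :
    |∑ i, ∑ j, M i j * ∑ k, u i k * v j k| ≤ s * t * B := by
  have h1 := h ι (fun i k => u i k / s) (fun j k => v j k / t)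
    (fun i => by
      simp only [div_pow, ← Finset.sum_div]
      exact (div_le_one (by positivity)).mpr (hu i))
    (fun j => by
      simp only [div_pow, ← Finset.sum_div]
      exact (div_le_one (by positivity)).mpr (hv j))
  have h2 : ∑ i, ∑ j, M i j * ∑ k, u i k / s * (v j k / t) =
      (∑ i, ∑ j, M i j * ∑ k, u i k * v j k) / (s * t) := by
    simp only [Finset.sum_div, mul_div_assoc, div_mul_div_comm]
  rw [h2, abs_div, abs_of_pos (mul_pos hs ht), div_le_iff₀ (mul_pos hs ht)] at h1
  linarith

/-- A crude bound: it makes the set of vector bounds nonempty, so that its infimum is meaningful. -/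
lemma isVectorBound_sum_abs (M : Fin m → Fin n → ℝ) : IsVectorBound M (∑ i, ∑ j, |M i j|) := by
  intro ι _ u v hu hv
  refine (Finset.abs_sum_le_sum_abs _ _).trans (Finset.sum_le_sum fun i _ => ?_)
  refine (Finset.abs_sum_le_sum_abs _ _).trans (Finset.sum_le_sum fun j _ => ?_)
  rw [abs_mul]
  refine mul_le_of_le_one_right (abs_nonneg _) (abs_le_one_iff_mul_self_le_one.mpr ?_)
  have := Finset.sum_mul_sq_le_sq_mul_sq Finset.univ (u i) (v j)
  have h0 : 0 ≤ ∑ k, v j k ^ 2 := Finset.sum_nonneg fun k _ => sq_nonneg _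
  nlinarith [hu i, hv j, Finset.sum_nonneg fun k (_ : k ∈ Finset.univ) => sq_nonneg (u i k)]

/-- Truncating Rademacher sums improves a bound on the vector values. -/
lemma IsVectorBound.improve {B : ℝ}
    (hM : ∀ (a : Fin m → ℤˣ) (b : Fin n → ℤˣ), |∑ i, ∑ j, M i j * (val (a i) * val (b j))| ≤ 1)
    (h : IsVectorBound M B) : IsVectorBound M (4 + B / 2) := by
  classical
  intro ι _ u v hu hv
  set W : ℝ := (Fintype.card (ι → ℤˣ) : ℝ) with hW
  have hW0 : 0 < W := by
    rw [hW]
    exact_mod_cast Fintype.card_pos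
  have hs : 0 < √W := Real.sqrt_pos.mpr hW0
  have hss : √W ^ 2 = W := Real.sq_sqrt hW0.le
  let R : (ι → ℝ) → (ι → ℤˣ) → ℝ := fun w ε => ∑ k, w k * val (ε k)
  have hR : ∀ w, ∑ k, w k ^ 2 ≤ 1 → ∑ ε, R w ε ^ 2 ≤ √W ^ 2 := fun w hw => by
    rw [hss]
    refine (sum_rademacher_sq_finset w Finset.univ).trans_le ?_
    exact mul_le_of_le_one_right hW0.le hw
  have hc : ∀ w, ∑ k, w k ^ 2 ≤ 1 → ∑ ε, clip (R w ε) ^ 2 ≤ √W ^ 2 := fun w hw =>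
    (Finset.sum_le_sum fun ε _ => clip_sq_le _).trans (hR w hw)
  -- The fourth moment is at most `3W`, and `3/64 ≤ 1/16`: the tail has norm at most `√W / 4`.
  have hr : ∀ w, ∑ k, w k ^ 2 ≤ 1 → ∑ ε, (R w ε - clip (R w ε)) ^ 2 ≤ (√W / 4) ^ 2 :=
    fun w hw => by
    have h1 : ∑ ε, (R w ε - clip (R w ε)) ^ 2 ≤ (∑ ε, R w ε ^ 4) / 64 := by
      rw [Finset.sum_div]
      exact Finset.sum_le_sum fun ε _ => sub_clip_sq_le _
    have h2 := sum_rademacher_pow_four_le w Finset.univ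
    have h3 : (∑ k, w k ^ 2) ^ 2 ≤ 1 := pow_le_one₀ (Finset.sum_nonneg fun k _ => sq_nonneg _) hw
    rw [div_pow, hss]
    have h4 : W * (3 * (∑ k, w k ^ 2) ^ 2) ≤ W * 3 := by
      have := mul_le_mul_of_nonneg_left h3 hW0.le
      linarith
    have h5 : ∑ ε, R w ε ^ 4 ≤ W * 3 := h2.trans h4
    linarith
  -- Inner products are averages of products of Rademacher sums. Each product splits into two
  -- truncations plus two terms containing a tail.
  have e : W * ∑ i, ∑ j, M i j * ∑ k, u i k * v j k =
      (∑ ε, ∑ i, ∑ j, M i j * (clip (R (u i) ε) * clip (R (v j) ε))) +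
        (∑ i, ∑ j, M i j * ∑ ε, (R (u i) ε - clip (R (u i) ε)) * R (v j) ε) +
        ∑ i, ∑ j, M i j * ∑ ε, clip (R (u i) ε) * (R (v j) ε - clip (R (v j) ε)) := by
    have e0 : ∑ ε, ∑ i, ∑ j, M i j * (clip (R (u i) ε) * clip (R (v j) ε)) =
        ∑ i, ∑ j, ∑ ε, M i j * (clip (R (u i) ε) * clip (R (v j) ε)) := by
      rw [Finset.sum_comm]
      exact Finset.sum_congr rfl fun i _ => Finset.sum_comm
    rw [e0, Finset.mul_sum, ← Finset.sum_add_distrib, ← Finset.sum_add_distrib]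
    refine Finset.sum_congr rfl fun i _ => ?_
    rw [Finset.mul_sum, ← Finset.sum_add_distrib, ← Finset.sum_add_distrib]
    refine Finset.sum_congr rfl fun j _ => ?_
    rw [mul_left_comm, ← sum_rademacher_mul, ← Finset.mul_sum, ← mul_add, ← mul_add,
      ← Finset.sum_add_distrib, ← Finset.sum_add_distrib]
    congr 1
    refine Finset.sum_congr rfl fun ε _ => ?_
    simp only [R]
    ring
  have b1 : |∑ ε, ∑ i, ∑ j, M i j * (clip (R (u i) ε) * clip (R (v j) ε))| ≤ W * 4 := by
    refine (Finset.abs_sum_le_sum_abs _ _).trans ?_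
    refine (Finset.sum_le_card_nsmul _ _ 4 fun ε _ => ?_).trans_eq ?_
    · have := bilinear_le_of_sign_bound hM (a := fun i => clip (R (u i) ε) / 2)
        (b := fun j => clip (R (v j) ε) / 2)
        (fun i => by rw [abs_div, abs_two]; linarith [abs_clip_le_two (R (u i) ε)])
        (fun j => by rw [abs_div, abs_two]; linarith [abs_clip_le_two (R (v j) ε)])
      have e1 : ∀ i j, M i j * (clip (R (u i) ε) / 2 * (clip (R (v j) ε) / 2)) =
          M i j * (clip (R (u i) ε) * clip (R (v j) ε)) / (2 * 2) := fun i j => by ring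
      simp only [e1, ← Finset.sum_div] at this
      rw [abs_div, div_le_iff₀ (by positivity), abs_of_pos (by norm_num : (0 : ℝ) < 2 * 2)] at this
      linarith
    · rw [nsmul_eq_mul, hW, Finset.card_univ]
  -- Functions on the cube are themselves vectors, so `h` applies to the tail terms; each costs `W *
  -- (B / 4)`.
  have b2 := h.scale (s := √W / 4) (t := √W) (by positivity) hs (fun i => hr (u i) (hu i))
    fun j => hR (v j) (hv j)
  have b3 := h.scale (s := √W) (t := √W / 4) hs (by positivity) (fun i => hc (u i) (hu i))
    fun j => hr (v j) (hv j)
  have hWW : √W * √W = W := Real.mul_self_sqrt hW0.le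
  have b2' : √W / 4 * √W * B = W * (B / 4) := by
    linear_combination (B / 4) * hWW
  have b3' : √W * (√W / 4) * B = W * (B / 4) := by
    linear_combination (B / 4) * hWW
  rw [b2'] at b2
  rw [b3'] at b3
  have : W * |∑ i, ∑ j, M i j * ∑ k, u i k * v j k| ≤ W * (4 + B / 2) := by
    rw [← abs_of_pos hW0, ← abs_mul, abs_of_pos hW0, e]
    refine (abs_add_three _ _ _).trans ?_
    linarith
  exact le_of_mul_le_mul_left this hW0

/-- The least vector bound `B` exists and satisfies `B ≤ 4 + B / 2`. -/
lemma isVectorBound_eight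
    (hM : ∀ (a : Fin m → ℤˣ) (b : Fin n → ℤˣ), |∑ i, ∑ j, M i j * (val (a i) * val (b j))| ≤ 1) :
    IsVectorBound M 8 := by
  have hne : {B | IsVectorBound M B}.Nonempty := ⟨_, isVectorBound_sum_abs M⟩
  have hbdd : BddBelow {B | IsVectorBound M B} := ⟨0, fun B hB => IsVectorBound.nonneg hB⟩
  have hinf : IsVectorBound M (sInf {B | IsVectorBound M B}) := fun ι _ u v hu hv =>
    le_csInf hne fun B hB => hB ι u v hu hv
  have := csInf_le hbdd (hinf.improve hM)
  intro ι _ u v hu hv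
  have := hinf ι u v hu hv
  linarith

end Grothendieck

/-- The real Grothendieck inequality. -/
theorem isGrothendieckBound_eight : IsGrothendieckBound 8 := by
  intro m n M hM H _ _ _ u v hu hv
  -- Finitely many vectors span a finite-dimensional space, where an orthonormal basis gives
  -- coordinates.
  let S : Submodule ℝ H := Submodule.span ℝ (Set.range u ∪ Set.range v)
  have : FiniteDimensional ℝ S :=
    FiniteDimensional.span_of_finite ℝ ((Set.finite_range u).union (Set.finite_range v))
  let u' : Fin m → S := fun i => ⟨u i, Submodule.subset_span (Or.inl ⟨i, rfl⟩)⟩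
  let v' : Fin n → S := fun j => ⟨v j, Submodule.subset_span (Or.inr ⟨j, rfl⟩)⟩
  let b := stdOrthonormalBasis ℝ S
  have hsq : ∀ w : S, ‖(w : H)‖ ≤ 1 → ∑ k, inner ℝ w (b k) ^ 2 ≤ 1 := fun w hw => by
    have h1 : ∑ k, inner ℝ w (b k) ^ 2 = ‖w‖ ^ 2 := by
      rw [← real_inner_self_eq_norm_sq, ← b.sum_inner_mul_inner]
      exact Finset.sum_congr rfl fun k _ => by rw [real_inner_comm w (b k), pow_two]
    rw [h1]
    exact pow_le_one₀ (norm_nonneg _) hw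
  have h := isVectorBound_eight hM (Fin (Module.finrank ℝ S))
    (fun i k => inner ℝ (u' i) (b k)) (fun j k => inner ℝ (v' j) (b k))
    (fun i => hsq _ (hu i)) fun j => hsq _ (hv j)
  convert h using 6 with i _ j _
  rw [show inner ℝ (u i) (v j) = inner ℝ (u' i) (v' j) from rfl, ← b.sum_inner_mul_inner]
  exact Finset.sum_congr rfl fun k _ => by rw [real_inner_comm (v' j) (b k)]

lemma IsGrothendieckBound.one_le {K : ℝ} (h : IsGrothendieckBound K) : 1 ≤ K := by
  have := h 1 1 (fun _ _ => 1) (fun a b => by simp [abs_mul, abs_val]) ℝ (fun _ => 1) (fun _ => 1)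
    (by simp) (by simp)
  simpa using this

lemma one_le_grothendieckConstant : 1 ≤ grothendieckConstant :=
  le_csInf ⟨8, isGrothendieckBound_eight⟩ fun _ hK => IsGrothendieckBound.one_le hK

/-- The infimum defining Grothendieck's constant is attained. -/
lemma isGrothendieckBound_grothendieckConstant : IsGrothendieckBound grothendieckConstant :=
  fun m n M hM H _ _ _ u v hu hv =>
    le_csInf ⟨8, isGrothendieckBound_eight⟩ fun _ hK => hK m n M hM H u v hu hv

/-- The homogeneous form of Grothendieck's inequality over arbitrary finite index types. -/
lemma grothendieck_inequality {m n : Type*} [Fintype m] [Fintype n] {M : m → n → ℝ} {C : ℝ}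
    (hM : ∀ (a : m → ℤˣ) (b : n → ℤˣ), |∑ i, ∑ j, M i j * (val (a i) * val (b j))| ≤ C)
    {H : Type} [NormedAddCommGroup H] [InnerProductSpace ℝ H] [CompleteSpace H]
    {u : m → H} {v : n → H} (hu : ∀ i, ‖u i‖ ≤ 1) (hv : ∀ j, ‖v j‖ ≤ 1) :
    |∑ i, ∑ j, M i j * inner ℝ (u i) (v j)| ≤ grothendieckConstant * C := by
  let e := Fintype.equivFin m
  let f := Fintype.equivFin n
  have hC : 0 ≤ C := (abs_nonneg _).trans (hM (fun _ => 1) fun _ => 1)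
  -- Since `C` may be zero, `M` is normalised by some `D > 0` above `C`, and `D` then tends to `C`.
  have key : ∀ D, C ≤ D → 0 < D →
      |∑ i, ∑ j, M i j * inner ℝ (u i) (v j)| ≤ grothendieckConstant * D := by
    intro D hCD hD
    have h := isGrothendieckBound_grothendieckConstant _ _
      (fun i j => M (e.symm i) (f.symm j) / D)
      (fun a b => by
        have h1 := hM (fun i => a (e i)) fun j => b (f j)
        rw [← e.symm.sum_comp] at h1
        simp only [← f.symm.sum_comp (fun j => M _ j * _), Equiv.apply_symm_apply] at h1
        simp only [div_mul_eq_mul_div, ← Finset.sum_div]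
        rw [abs_div, abs_of_pos hD, div_le_one hD]
        exact h1.trans hCD) H (fun i => u (e.symm i)) (fun j => v (f.symm j))
      (fun i => hu _) fun j => hv _
    simp only [div_mul_eq_mul_div, ← Finset.sum_div] at h
    rw [abs_div, abs_of_pos hD, div_le_iff₀ hD] at h
    rw [← e.symm.sum_comp]
    simp only [← f.symm.sum_comp (fun j => M _ j * _)]
    exact h
  have hK : 0 < grothendieckConstant := one_pos.trans_le one_le_grothendieckConstant
  refine le_of_forall_pos_le_add fun δ hδ => ?_
  have := key (C + δ / grothendieckConstant) (by linarith [div_pos hδ hK])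
    (by linarith [div_pos hδ hK])
  rwa [mul_add, mul_div_cancel₀ _ hK.ne'] at this

/-! ### The entrywise norm of a matrix and its norm on signs -/

/-- Littlewood's mixed-norm argument: the sum of the absolute values of the entries of a matrix
is at most `√(2 |m|)` times its norm as a bilinear form on signs. -/
lemma sum_abs_le_sqrt_mul {m n : Type*} [Fintype m] [Fintype n] {T : m → n → ℝ} {C : ℝ}
    (hT : ∀ (a : m → ℤˣ) (b : n → ℤˣ), |∑ i, ∑ j, T i j * (val (a i) * val (b j))| ≤ C) :
    ∑ i, ∑ j, |T i j| ≤ √(2 * Fintype.card m) * C := by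
  classical
  set W : ℝ := (Fintype.card (m → ℤˣ) : ℝ) with hW
  have hW0 : 0 < W := by
    rw [hW]
    exact_mod_cast Fintype.card_pos
  -- Cauchy–Schwarz within each column; the column ℓ₂ norms are then averaged over row signs by
  -- Khintchine in `h3`.
  have h1 : ∀ j, ∑ i, |T i j| ≤ √(Fintype.card m) * √(∑ i, T i j ^ 2) := fun j => by
    rw [← Real.sqrt_mul (by positivity)]
    refine Real.le_sqrt_of_sq_le ?_
    have := sq_sum_le_card_mul_sum_sq (s := (Finset.univ : Finset m)) (f := fun i => |T i j|)
    simpa [sq_abs] using this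
  have h2 : ∀ ε : m → ℤˣ, ∑ j, |∑ i, T i j * val (ε i)| ≤ C := fun ε => by
    refine sum_abs_le_of_sign_bound _ fun s => ?_
    convert hT ε s using 2
    rw [Finset.sum_comm]
    simp only [Finset.sum_mul]
    exact Finset.sum_congr rfl fun i _ => Finset.sum_congr rfl fun j _ => by ring
  have h3 : ∑ j, W * √(∑ i, T i j ^ 2) ≤ √2 * (W * C) := by
    refine (Finset.sum_le_sum fun j _ => khintchine fun i => T i j).trans ?_
    rw [← Finset.mul_sum, Finset.sum_comm]
    refine mul_le_mul_of_nonneg_left ?_ (Real.sqrt_nonneg _)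
    refine (Finset.sum_le_card_nsmul _ _ C fun ε _ => h2 ε).trans_eq ?_
    rw [nsmul_eq_mul, hW, Finset.card_univ]
  have h4 : ∑ j, √(∑ i, T i j ^ 2) ≤ √2 * C := by
    rw [← Finset.mul_sum, mul_left_comm] at h3
    exact le_of_mul_le_mul_left h3 hW0
  rw [Finset.sum_comm]
  calc ∑ j, ∑ i, |T i j| ≤ √(Fintype.card m) * ∑ j, √(∑ i, T i j ^ 2) := by
        rw [Finset.mul_sum]
        exact Finset.sum_le_sum fun j _ => h1 j
    _ ≤ √(Fintype.card m) * (√2 * C) := mul_le_mul_of_nonneg_left h4 (Real.sqrt_nonneg _)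
    _ = √(2 * Fintype.card m) * C := by
        rw [Real.sqrt_mul zero_le_two]
        ring

/-! ### Marginal correlations and unbiased boxes -/

section Boxes

variable {N : ℕ}

/-- The expected outcome of one party. -/
noncomputable def corr₁ (P : Fin N → ℤˣ → ℝ) (x : Fin N) : ℝ := ∑ a, val a * P x a

/-- The correlation of a two-party box. -/
noncomputable def corr₂ (Q : Fin N → Fin N → ℤˣ → ℤˣ → ℝ) (x y : Fin N) : ℝ :=
  ∑ a, ∑ b, val a * val b * Q x y a b

/-- The one-party conditional distribution with expected outcomes `r`. -/
noncomputable def box₁ (r : Fin N → ℝ) (x : Fin N) (a : ℤˣ) : ℝ := (1 + val a * r x) / 2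

/-- The two-party box with correlations `q` and uniform marginals. -/
noncomputable def box₂ (q : Fin N → Fin N → ℝ) (x y : Fin N) (a b : ℤˣ) : ℝ :=
  (1 + val a * val b * q x y) / 4

lemma abs_corr₁_le {P : Fin N → ℤˣ → ℝ} (h : IsCondDist₁ P) (x : Fin N) : |corr₁ P x| ≤ 1 := by
  have h1 := h.2 x
  have h2 := h.1 x 1
  have h3 := h.1 x (-1)
  simp only [corr₁, sum_sign, val_neg, val_one] at h1 ⊢
  rw [abs_le]
  constructor <;> linarith

lemma abs_corr₂_le {Q : Fin N → Fin N → ℤˣ → ℤˣ → ℝ} (h : IsCondDist₂ Q) (x y : Fin N) :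
    |corr₂ Q x y| ≤ 1 := by
  have h1 := h.2 x y
  have h2 := h.1 x y 1 1
  have h3 := h.1 x y (-1) 1
  have h4 := h.1 x y 1 (-1)
  have h5 := h.1 x y (-1) (-1)
  simp only [corr₂, sum_sign, val_neg, val_one] at h1 ⊢
  rw [abs_le]
  constructor <;> linarith

lemma isCondDist₁_box₁ {r : Fin N → ℝ} (hr : ∀ x, |r x| ≤ 1) : IsCondDist₁ (box₁ r) := by
  refine ⟨fun x a => ?_, fun x => ?_⟩
  · have := abs_le.mp (hr x)
    unfold box₁
    rcases val_eq_or a with h | h <;> rw [h] <;> linarith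
  · simp only [box₁, sum_sign, val_neg, val_one]
    ring

lemma corr₁_box₁ (r : Fin N → ℝ) : corr₁ (box₁ r) = r := by
  ext x
  simp only [corr₁, box₁, sum_sign, val_neg, val_one]
  ring

lemma isCondDist₂_box₂ {q : Fin N → Fin N → ℝ} (hq : ∀ x y, |q x y| ≤ 1) :
    IsCondDist₂ (box₂ q) := by
  refine ⟨fun x y a b => ?_, fun x y => ?_⟩
  · have := abs_le.mp (hq x y)
    unfold box₂
    rcases val_eq_or a with h | h <;> rcases val_eq_or b with h' | h' <;> rw [h, h'] <;> linarith
  · simp only [box₂, sum_sign, val_neg, val_one]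
    ring

lemma isNonSignalling_box₂ (q : Fin N → Fin N → ℝ) : IsNonSignalling (box₂ q) := by
  refine ⟨fun x x' y b => ?_, fun x y y' a => ?_⟩ <;>
  · simp only [box₂, sum_sign, val_neg, val_one]
    ring

lemma corr₂_box₂ (q : Fin N → Fin N → ℝ) : corr₂ (box₂ q) = q := by
  ext x y
  simp only [corr₂, box₂, sum_sign, val_neg, val_one]
  ring

/-! ### Correlations of local and bilocal behaviours -/

/-- The correlation of a mixture of products, over the three bipartitions. -/
lemma correlation_bilocal {n : ℕ} {p₁₂ p₁₃ p₂₃ : Fin n → ℝ}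
    {Q₁₂ Q₁₃ Q₂₃ : Fin n → Fin N → Fin N → ℤˣ → ℤˣ → ℝ} {P₁ P₂ P₃ : Fin n → Fin N → ℤˣ → ℝ}
    {P : Behaviour N}
    (hP : ∀ x y z a b c, P x y z a b c =
      ∑ l, (p₁₂ l * (Q₁₂ l x y a b * P₃ l z c) + p₁₃ l * (Q₁₃ l x z a c * P₂ l y b) +
        p₂₃ l * (Q₂₃ l y z b c * P₁ l x a))) (x y z : Fin N) :
    correlation P x y z =
      ∑ l, (p₁₂ l * (corr₂ (Q₁₂ l) x y * corr₁ (P₃ l) z) +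
        p₁₃ l * (corr₂ (Q₁₃ l) x z * corr₁ (P₂ l) y) +
        p₂₃ l * (corr₂ (Q₂₃ l) y z * corr₁ (P₁ l) x)) := by
  simp only [correlation, hP, sum_sign, corr₁, corr₂, val_neg, val_one, Finset.mul_sum,
    ← Finset.sum_add_distrib]
  refine Finset.sum_congr rfl fun l _ => ?_
  ring

/-- Replacing each two-party box by the uniform-marginal box with the same `corr₂` leaves the
correlation unchanged. -/
lemma nsBLcor_eq_BLcor : nsBLcor N = BLcor N := by
  apply Set.Subset.antisymm
  · rintro _ ⟨P, ⟨n, p₁₂, p₁₃, p₂₃, Q₁₂, Q₁₃, Q₂₃, P₁, P₂, P₃, h₁₂, h₁₃, h₂₃, hp, hQ₁₂, hQ₁₃, hQ₂₃,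
      hP₁, hP₂, hP₃, hP⟩, rfl⟩
    exact ⟨P, ⟨n, p₁₂, p₁₃, p₂₃, Q₁₂, Q₁₃, Q₂₃, P₁, P₂, P₃, h₁₂, h₁₃, h₂₃, hp,
      fun l => ⟨(hQ₁₂ l).1, trivial⟩, fun l => ⟨(hQ₁₃ l).1, trivial⟩,
      fun l => ⟨(hQ₂₃ l).1, trivial⟩, hP₁, hP₂, hP₃, hP⟩, rfl⟩
  · rintro _ ⟨P, ⟨n, p₁₂, p₁₃, p₂₃, Q₁₂, Q₁₃, Q₂₃, P₁, P₂, P₃, h₁₂, h₁₃, h₂₃, hp, hQ₁₂, hQ₁₃, hQ₂₃,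
      hP₁, hP₂, hP₃, hP⟩, rfl⟩
    refine ⟨_, ⟨n, p₁₂, p₁₃, p₂₃, fun l => box₂ (corr₂ (Q₁₂ l)), fun l => box₂ (corr₂ (Q₁₃ l)),
      fun l => box₂ (corr₂ (Q₂₃ l)), P₁, P₂, P₃, h₁₂, h₁₃, h₂₃, hp,
      fun l => ⟨isCondDist₂_box₂ (abs_corr₂_le (hQ₁₂ l).1), isNonSignalling_box₂ _⟩,
      fun l => ⟨isCondDist₂_box₂ (abs_corr₂_le (hQ₁₃ l).1), isNonSignalling_box₂ _⟩,
      fun l => ⟨isCondDist₂_box₂ (abs_corr₂_le (hQ₂₃ l).1), isNonSignalling_box₂ _⟩,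
      hP₁, hP₂, hP₃, fun x y z a b c => rfl⟩, ?_⟩
    ext x y z
    rw [correlation_bilocal (fun x y z a b c => rfl), correlation_bilocal hP]
    simp only [corr₂_box₂]

lemma mem_BLcor {q : Fin N → Fin N → ℝ} {r : Fin N → ℝ} (hq : ∀ x y, |q x y| ≤ 1)
    (hr : ∀ z, |r z| ≤ 1) : (fun x y z => q x y * r z : Table N) ∈ BLcor N := by
  have hQ := isCondDist₂_box₂ hq
  have hR := isCondDist₁_box₁ hr
  refine ⟨_, ⟨1, fun _ => 1, fun _ => 0, fun _ => 0, fun _ => box₂ q, fun _ => box₂ q,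
    fun _ => box₂ q, fun _ => box₁ r, fun _ => box₁ r, fun _ => box₁ r, by simp, by simp, by simp,
    by simp, fun _ => ⟨hQ, trivial⟩, fun _ => ⟨hQ, trivial⟩, fun _ => ⟨hQ, trivial⟩, fun _ => hR,
    fun _ => hR, fun _ => hR, fun x y z a b c => rfl⟩, ?_⟩
  ext x y z
  rw [correlation_bilocal (fun x y z a b c => rfl)]
  simp [corr₁_box₁, corr₂_box₂]

lemma mem_Lcor {a b c : Fin N → ℝ} (ha : ∀ x, |a x| ≤ 1) (hb : ∀ y, |b y| ≤ 1)
    (hc : ∀ z, |c z| ≤ 1) : (fun x y z => a x * b y * c z : Table N) ∈ Lcor N := by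
  refine ⟨_, ⟨1, fun _ => 1, fun _ => box₁ a, fun _ => box₁ b, fun _ => box₁ c, by simp, by simp,
    fun _ => isCondDist₁_box₁ ha, fun _ => isCondDist₁_box₁ hb, fun _ => isCondDist₁_box₁ hc,
    fun x y z a b c => rfl⟩, ?_⟩
  ext x y z
  simp only [correlation, sum_sign, val_neg, val_one, Finset.univ_unique, Finset.sum_singleton,
    box₁]
  ring

/-! ### Bounds on the values of Bell functionals -/

lemma pairing_sum {κ : Type*} [Fintype κ] (M : Table N) (f : κ → Table N) :
    pairing M (fun x y z => ∑ l, f l x y z) = ∑ l, pairing M (f l) := by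
  simp only [pairing, Finset.mul_sum]
  rw [Finset.sum_comm (s := (Finset.univ : Finset κ))]
  refine Finset.sum_congr rfl fun x _ => ?_
  rw [Finset.sum_comm (s := (Finset.univ : Finset κ))]
  exact Finset.sum_congr rfl fun y _ => Finset.sum_comm

/-- By convexity, only products over a single bipartition need to be bounded. -/
lemma abs_pairing_BLcor_le {M : Table N} {C : ℝ}
    (h₁₂ : ∀ (q : Fin N → Fin N → ℝ) (r : Fin N → ℝ), (∀ x y, |q x y| ≤ 1) → (∀ z, |r z| ≤ 1) →
      |pairing M fun x y z => q x y * r z| ≤ C)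
    (h₁₃ : ∀ (q : Fin N → Fin N → ℝ) (r : Fin N → ℝ), (∀ x y, |q x y| ≤ 1) → (∀ z, |r z| ≤ 1) →
      |pairing M fun x y z => q x z * r y| ≤ C)
    (h₂₃ : ∀ (q : Fin N → Fin N → ℝ) (r : Fin N → ℝ), (∀ x y, |q x y| ≤ 1) → (∀ z, |r z| ≤ 1) →
      |pairing M fun x y z => q y z * r x| ≤ C)
    {γ : Table N} (hγ : γ ∈ BLcor N) : |pairing M γ| ≤ C := by
  obtain ⟨P, ⟨n, p₁₂, p₁₃, p₂₃, Q₁₂, Q₁₃, Q₂₃, P₁, P₂, P₃, hp₁₂, hp₁₃, hp₂₃, hp, hQ₁₂, hQ₁₃, hQ₂₃,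
      hP₁, hP₂, hP₃, hP⟩, rfl⟩ := hγ
  have e : pairing M (correlation P) =
      ∑ l, (p₁₂ l * (pairing M fun x y z => corr₂ (Q₁₂ l) x y * corr₁ (P₃ l) z) +
        p₁₃ l * (pairing M fun x y z => corr₂ (Q₁₃ l) x z * corr₁ (P₂ l) y) +
        p₂₃ l * (pairing M fun x y z => corr₂ (Q₂₃ l) y z * corr₁ (P₁ l) x)) := by
    have h : correlation P = fun x y z => ∑ l, _ :=
      funext₃ fun x y z => correlation_bilocal hP x y z
    rw [h]
    refine (pairing_sum M _).trans ?_
    refine Finset.sum_congr rfl fun l _ => ?_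
    simp only [pairing, Finset.mul_sum, ← Finset.sum_add_distrib]
    exact Finset.sum_congr rfl fun x _ => Finset.sum_congr rfl fun y _ =>
      Finset.sum_congr rfl fun z _ => by ring
  rw [e]
  calc _ ≤ ∑ l, (p₁₂ l + p₁₃ l + p₂₃ l) * C := by
        refine (Finset.abs_sum_le_sum_abs _ _).trans (Finset.sum_le_sum fun l _ => ?_)
        refine (abs_add_three _ _ _).trans ?_
        rw [abs_mul, abs_mul, abs_mul, abs_of_nonneg (hp₁₂ l), abs_of_nonneg (hp₁₃ l),
          abs_of_nonneg (hp₂₃ l), add_mul, add_mul]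
        have k₁ := h₁₂ _ _ (abs_corr₂_le (hQ₁₂ l).1) (abs_corr₁_le (hP₃ l))
        have k₂ := h₁₃ _ _ (abs_corr₂_le (hQ₁₃ l).1) (abs_corr₁_le (hP₂ l))
        have k₃ := h₂₃ _ _ (abs_corr₂_le (hQ₂₃ l).1) (abs_corr₁_le (hP₁ l))
        exact add_le_add (add_le_add (mul_le_mul_of_nonneg_left k₁ (hp₁₂ l))
          (mul_le_mul_of_nonneg_left k₂ (hp₁₃ l))) (mul_le_mul_of_nonneg_left k₃ (hp₂₃ l))
    _ = C := by rw [← Finset.sum_mul, hp, one_mul]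

/-- The value of a functional on products of a two-index table and a vector, in terms of its value
on products of signs and a vector. -/
lemma abs_sum_mul_le_sqrt_mul {F : Table N} {C : ℝ}
    (hF : ∀ a b c : Fin N → ℝ, (∀ x, |a x| ≤ 1) → (∀ y, |b y| ≤ 1) → (∀ z, |c z| ≤ 1) →
      |∑ x, ∑ y, ∑ z, F x y z * (a x * b y * c z)| ≤ C)
    {q : Fin N → Fin N → ℝ} {r : Fin N → ℝ} (hq : ∀ x y, |q x y| ≤ 1) (hr : ∀ z, |r z| ≤ 1) :
    |∑ x, ∑ y, ∑ z, F x y z * (q x y * r z)| ≤ √(2 * N) * C := by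
  have h := sum_abs_le_sqrt_mul (T := fun x y => ∑ z, F x y z * r z) (C := C) fun a b => by
    refine le_of_eq_of_le ?_ (hF (fun x => val (a x)) (fun y => val (b y)) r
      (fun x => (abs_val _).le) (fun y => (abs_val _).le) hr)
    simp only [Finset.sum_mul]
    congr 1
    exact Finset.sum_congr rfl fun x _ => Finset.sum_congr rfl fun y _ =>
      Finset.sum_congr rfl fun z _ => by ring
  rw [Fintype.card_fin] at h
  refine le_trans ?_ h
  refine (Finset.abs_sum_le_sum_abs _ _).trans (Finset.sum_le_sum fun x _ => ?_)
  refine le_of_eq_of_le ?_ (abs_sum_mul_le (hq x) _)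
  simp only [Finset.sum_mul]
  congr 1
  exact Finset.sum_congr rfl fun y _ => Finset.sum_congr rfl fun z _ => by ring

lemma abs_pairing_BLcor_le_sqrt_mul {M : Table N} {C : ℝ}
    (hM : ∀ a b c : Fin N → ℝ, (∀ x, |a x| ≤ 1) → (∀ y, |b y| ≤ 1) → (∀ z, |c z| ≤ 1) →
      |pairing M fun x y z => a x * b y * c z| ≤ C)
    {γ : Table N} (hγ : γ ∈ BLcor N) : |pairing M γ| ≤ √(2 * N) * C := by
  refine abs_pairing_BLcor_le (fun q r hq hr => ?_) (fun q r hq hr => ?_) (fun q r hq hr => ?_) hγ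
  · exact abs_sum_mul_le_sqrt_mul hM hq hr
  · have e : ∀ f : Table N, ∑ x, ∑ z, ∑ y, f x y z = ∑ x, ∑ y, ∑ z, f x y z := fun f =>
      Finset.sum_congr rfl fun x _ => Finset.sum_comm
    have := abs_sum_mul_le_sqrt_mul (F := fun x z y => M x y z) (fun a c b ha hc hb => by
      rw [e fun x y z => M x y z * (a x * c z * b y)]
      simpa only [pairing, mul_right_comm] using hM a b c ha hb hc) hq hr
    rwa [e fun x y z => M x y z * (q x z * r y)] at this
  · have e : ∀ f : Table N, ∑ y, ∑ z, ∑ x, f x y z = ∑ x, ∑ y, ∑ z, f x y z := fun f => by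
      rw [Finset.sum_comm (t := Finset.univ (α := Fin N)) (f := fun x y => ∑ z, f x y z)]
      exact Finset.sum_congr rfl fun y _ => Finset.sum_comm
    have := abs_sum_mul_le_sqrt_mul (F := fun y z x => M x y z) (fun b c a hb hc ha => by
      rw [e fun x y z => M x y z * (b y * c z * a x)]
      refine le_of_eq_of_le ?_ (hM a b c ha hb hc)
      simp only [pairing]
      congr 1
      exact Finset.sum_congr rfl fun x _ => Finset.sum_congr rfl fun y _ =>
        Finset.sum_congr rfl fun z _ => by ring) hq hr
    rwa [e fun x y z => M x y z * (q y z * r x)] at this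

/-! ### The suprema `ω` -/

lemma le_omega {A : Set (Table N)} {γ : Table N} (hγ : γ ∈ A) (M : Table N) :
    ENNReal.ofReal |pairing M γ| ≤ omega A M :=
  le_iSup₂_of_le γ hγ le_rfl

lemma abs_pairing_le_toReal {A : Set (Table N)} {M : Table N} (hA : omega A M ≠ ⊤) {γ : Table N}
    (hγ : γ ∈ A) : |pairing M γ| ≤ (omega A M).toReal := by
  rw [← ENNReal.toReal_ofReal (abs_nonneg (pairing M γ))]
  exact ENNReal.toReal_mono hA (le_omega hγ M)

/-- Reduces inequalities between suprema to real ones: for `K > 0` an infinite right-hand side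
leaves nothing to prove. -/
lemma omega_le_ofReal_mul {A B : Set (Table N)} {M : Table N} {K : ℝ} (hK : 0 < K)
    (h : omega B M ≠ ⊤ → ∀ γ ∈ A, |pairing M γ| ≤ K * (omega B M).toReal) :
    omega A M ≤ ENNReal.ofReal K * omega B M := by
  by_cases hB : omega B M = ⊤
  · simp [hB, ENNReal.mul_top, hK]
  · refine iSup₂_le fun γ hγ => ?_
    rw [← ENNReal.ofReal_toReal hB, ← ENNReal.ofReal_mul hK.le]
    exact ENNReal.ofReal_le_ofReal (h hB γ hγ)

lemma LV_le {A B : Set (Table N)} {K : ℝ≥0∞} (h : ∀ M, omega A M ≤ K * omega B M) :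
    LV A B ≤ K :=
  iSup_le fun M => ENNReal.div_le_of_le_mul (h M)

lemma omega_BLcor_le (M : Table N) :
    omega (BLcor N) M ≤ ENNReal.ofReal √(2 * N) * omega (Lcor N) M := by
  rcases Nat.eq_zero_or_pos N with rfl | hN
  -- With no inputs every pairing is an empty sum; this case is separate because `√(2 * 0)` is not
  -- positive.
  · simp [omega, pairing]
  · have : (0 : ℝ) < N := by exact_mod_cast hN
    exact omega_le_ofReal_mul (by positivity) fun hL γ hγ =>
      abs_pairing_BLcor_le_sqrt_mul (fun a b c ha hb hc =>
        abs_pairing_le_toReal hL (mem_Lcor ha hb hc)) hγ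

end Boxes

/-! ### Operators on the Hilbert space tensor product -/

section Completion

variable {E F : Type*} [NormedAddCommGroup E] [InnerProductSpace ℂ E]
  [NormedAddCommGroup F] [InnerProductSpace ℂ F]

lemma completion_ext {f g : UniformSpace.Completion E →L[ℂ] UniformSpace.Completion F}
    (h : ∀ x : E, f x = g x) : f = g := by
  ext x
  induction x using UniformSpace.Completion.induction_on with
  | hp => exact isClosed_eq f.continuous g.continuous
  | ih x => exact h x

lemma norm_completion_le (f : E →L[ℂ] F) : ‖f.completion‖ ≤ ‖f‖ := by
  refine ContinuousLinearMap.opNorm_le_bound _ (norm_nonneg f) fun x => ?_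
  induction x using UniformSpace.Completion.induction_on with
  | hp => exact isClosed_le f.completion.continuous.norm (continuous_const.mul continuous_norm)
  | ih x =>
    rw [ContinuousLinearMap.completion_apply_coe, UniformSpace.Completion.norm_coe,
      UniformSpace.Completion.norm_coe]
    exact f.le_opNorm x

lemma inner_completion_coe (x y : E) :
    inner ℂ (x : UniformSpace.Completion E) (y : UniformSpace.Completion E) = inner ℂ x y :=
  UniformSpace.Completion.inner_coe x y

end Completion

section TensorOp

variable {H₁ H₂ H₃ : Type}
  [NormedAddCommGroup H₁] [InnerProductSpace ℂ H₁] [NormedAddCommGroup H₂]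
  [InnerProductSpace ℂ H₂] [NormedAddCommGroup H₃] [InnerProductSpace ℂ H₃]

lemma tensorOp_coe (A : H₁ →L[ℂ] H₁) (B : H₂ →L[ℂ] H₂) (C : H₃ →L[ℂ] H₃)
    (x : H₁ ⊗[ℂ] (H₂ ⊗[ℂ] H₃)) :
    tensorOp A B C x =
      ((TensorProduct.mapL A (TensorProduct.mapL B C) x : H₁ ⊗[ℂ] (H₂ ⊗[ℂ] H₃)) :
        HilbertTensor₃ H₁ H₂ H₃) :=
  ContinuousLinearMap.completion_apply_coe _ _

lemma norm_tensorOp_le {A : H₁ →L[ℂ] H₁} {B : H₂ →L[ℂ] H₂} {C : H₃ →L[ℂ] H₃} (hA : ‖A‖ ≤ 1)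
    (hB : ‖B‖ ≤ 1) (hC : ‖C‖ ≤ 1) : ‖tensorOp A B C‖ ≤ 1 := by
  refine (norm_completion_le _).trans ((TensorProduct.norm_mapL_le _ _).trans ?_)
  refine mul_le_one₀ hA (norm_nonneg _) ((TensorProduct.norm_mapL_le _ _).trans ?_)
  exact mul_le_one₀ hB (norm_nonneg _) hC

lemma tensorOp_mul (A A' : H₁ →L[ℂ] H₁) (B B' : H₂ →L[ℂ] H₂) (C C' : H₃ →L[ℂ] H₃) :
    tensorOp (A * A') (B * B') (C * C') = tensorOp A B C * tensorOp A' B' C' := by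
  refine completion_ext fun x => ?_
  rw [mul_apply_eq_comp, tensorOp_coe, tensorOp_coe, tensorOp_coe,
    TensorProduct.mapL_mul, TensorProduct.mapL_mul, mul_apply_eq_comp]

lemma tensorOp_sub_left (A A' : H₁ →L[ℂ] H₁) (B : H₂ →L[ℂ] H₂) (C : H₃ →L[ℂ] H₃) :
    tensorOp (A - A') B C = tensorOp A B C - tensorOp A' B C := by
  rw [eq_sub_iff_add_eq]
  refine completion_ext fun x => ?_
  rw [add_apply, tensorOp_coe, tensorOp_coe, tensorOp_coe,
    ← UniformSpace.Completion.coe_add, ← add_apply,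
    ← TensorProduct.mapL_add_left, sub_add_cancel]

lemma tensorOp_sub_middle (A : H₁ →L[ℂ] H₁) (B B' : H₂ →L[ℂ] H₂) (C : H₃ →L[ℂ] H₃) :
    tensorOp A (B - B') C = tensorOp A B C - tensorOp A B' C := by
  rw [eq_sub_iff_add_eq]
  refine completion_ext fun x => ?_
  rw [add_apply, tensorOp_coe, tensorOp_coe, tensorOp_coe,
    ← UniformSpace.Completion.coe_add, ← add_apply,
    ← TensorProduct.mapL_add_right, ← TensorProduct.mapL_add_left, sub_add_cancel]

lemma tensorOp_sub_right (A : H₁ →L[ℂ] H₁) (B : H₂ →L[ℂ] H₂) (C C' : H₃ →L[ℂ] H₃) :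
    tensorOp A B (C - C') = tensorOp A B C - tensorOp A B C' := by
  rw [eq_sub_iff_add_eq]
  refine completion_ext fun x => ?_
  rw [add_apply, tensorOp_coe, tensorOp_coe, tensorOp_coe,
    ← UniformSpace.Completion.coe_add, ← add_apply,
    ← TensorProduct.mapL_add_right, ← TensorProduct.mapL_add_right, sub_add_cancel]

/-- Product vectors. -/
noncomputable def pureTensor (e₁ : H₁) (e₂ : H₂) (e₃ : H₃) : HilbertTensor₃ H₁ H₂ H₃ :=
  ((e₁ ⊗ₜ[ℂ] (e₂ ⊗ₜ[ℂ] e₃) : H₁ ⊗[ℂ] (H₂ ⊗[ℂ] H₃)) : HilbertTensor₃ H₁ H₂ H₃)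

lemma norm_pureTensor (e₁ : H₁) (e₂ : H₂) (e₃ : H₃) :
    ‖pureTensor e₁ e₂ e₃‖ = ‖e₁‖ * (‖e₂‖ * ‖e₃‖) := by
  rw [pureTensor, UniformSpace.Completion.norm_coe, TensorProduct.norm_tmul,
    TensorProduct.norm_tmul]

lemma inner_coe_tensor (x y : H₁ ⊗[ℂ] (H₂ ⊗[ℂ] H₃)) :
    inner ℂ (x : HilbertTensor₃ H₁ H₂ H₃) (y : HilbertTensor₃ H₁ H₂ H₃) = inner ℂ x y :=
  inner_completion_coe x y

lemma inner_tensorOp_pureTensor (A : H₁ →L[ℂ] H₁) (B : H₂ →L[ℂ] H₂) (C : H₃ →L[ℂ] H₃)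
    (e₁ : H₁) (e₂ : H₂) (e₃ : H₃) :
    inner ℂ (pureTensor e₁ e₂ e₃) (tensorOp A B C (pureTensor e₁ e₂ e₃)) =
      inner ℂ e₁ (A e₁) * (inner ℂ e₂ (B e₂) * inner ℂ e₃ (C e₃)) := by
  rw [pureTensor, tensorOp_coe, TensorProduct.mapL_tmul, TensorProduct.mapL_tmul]
  have h₁ := TensorProduct.inner_tmul (𝕜 := ℂ) e₂ (B e₂) e₃ (C e₃)
  have h₂ := TensorProduct.inner_tmul (𝕜 := ℂ) e₁ (A e₁) (e₂ ⊗ₜ[ℂ] e₃) (B e₂ ⊗ₜ[ℂ] C e₃)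
  rw [h₁] at h₂
  rw [← h₂]
  exact inner_coe_tensor _ _

end TensorOp

/-! ### Quantum correlations -/

section Quantum

variable {N : ℕ}

/-- The difference of the two effects of a measurement is a contraction. -/
lemma norm_sub_le_one {H : Type} [NormedAddCommGroup H] [InnerProductSpace ℂ H]
    {E F : H →L[ℂ] H} (hE : E.IsPositive) (hF : F.IsPositive) (hEF : E + F = 1) :
    ‖E - F‖ ≤ 1 := by
  refine ContinuousLinearMap.opNorm_le_bound _ zero_le_one fun v => ?_
  rw [one_mul]
  have hv : v = E v + F v := by
    rw [← add_apply, hEF, one_apply_eq_self]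
  -- `F = 1 - E` commutes with `E`. This makes `Re ⟨E v, F v⟩` nonnegative, and `‖E v - F v‖² = ‖v‖²
  -- - 4 Re ⟨E v, F v⟩`.
  have comm : F (E v) = E (F v) := by
    have h1 : E v = E (E v) + E (F v) := by rw [← map_add, ← hv]
    have h2 : E v = E (E v) + F (E v) := by
      rw [← add_apply, hEF, one_apply_eq_self]
    exact add_left_cancel (h2.symm.trans h1)
  have h1 : 0 ≤ (inner ℂ (E v) (F (E v))).re := hF.re_inner_nonneg_right _
  have h2 : 0 ≤ (inner ℂ (F v) (E (F v))).re := hE.re_inner_nonneg_right _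
  have key : 0 ≤ (inner ℂ (E v) (F v)).re := by
    have h3 : inner ℂ (E v) (F v) = inner ℂ (E v) (F (E v)) + inner ℂ (F v) (E (F v)) := by
      have hFv : F v = F (E v) + F (F v) := by rw [← map_add, ← hv]
      conv_lhs => rw [hFv]
      rw [inner_add_right, ← hF.inner_left_eq_inner_right (E v) (F v), comm,
        hE.inner_left_eq_inner_right (F v) (F v)]
    rw [h3, Complex.add_re]
    exact add_nonneg h1 h2
  have n1 := norm_add_sq (𝕜 := ℂ) (E v) (F v)
  have n2 := norm_sub_sq (𝕜 := ℂ) (E v) (F v)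
  rw [← hv] at n1
  refine (pow_le_pow_iff_left₀ (norm_nonneg _) (norm_nonneg _) two_ne_zero).mp ?_
  rw [sub_apply, n1, n2]
  have : RCLike.re (inner ℂ (E v) (F v)) = (inner ℂ (E v) (F v)).re := rfl
  linarith

/-- A quantum correlation is given by three families of contractions of a Hilbert space
and a unit vector. -/
lemma exists_operators_of_mem_Qcor {γ : Table N} (hγ : γ ∈ Qcor N) :
    ∃ (H : Type) (_ : NormedAddCommGroup H) (_ : InnerProductSpace ℂ H) (_ : CompleteSpace H)
      (A B C : Fin N → H →L[ℂ] H) (ψ : H), ‖ψ‖ = 1 ∧ (∀ x, ‖A x‖ ≤ 1) ∧ (∀ y, ‖B y‖ ≤ 1) ∧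
      (∀ z, ‖C z‖ ≤ 1) ∧ ∀ x y z, γ x y z = (inner ℂ ψ (A x (B y (C z ψ)))).re := by
  obtain ⟨P, ⟨H₁, H₂, H₃, _, _, _, _, _, _, _, _, _, E₁, E₂, E₃, ψ, h₁, h₂, h₃, hψ, hP⟩, rfl⟩ := hγ
  have hn : ∀ {H : Type} [NormedAddCommGroup H] [InnerProductSpace ℂ H]
      {E : Fin N → ℤˣ → H →L[ℂ] H}, IsMeasurement E → ∀ x, ‖E x 1 - E x (-1)‖ ≤ 1 :=
    fun h x => norm_sub_le_one (h.1 x 1) (h.1 x (-1)) (by rw [← sum_sign, h.2])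
  have h1 : ∀ {H : Type} [NormedAddCommGroup H] [InnerProductSpace ℂ H], ‖(1 : H →L[ℂ] H)‖ ≤ 1 :=
    ContinuousLinearMap.norm_id_le
  refine ⟨HilbertTensor₃ H₁ H₂ H₃, inferInstance, inferInstance, inferInstance,
    fun x => tensorOp (E₁ x 1 - E₁ x (-1)) 1 1, fun y => tensorOp 1 (E₂ y 1 - E₂ y (-1)) 1,
    fun z => tensorOp 1 1 (E₃ z 1 - E₃ z (-1)), ψ, hψ, fun x => norm_tensorOp_le (hn h₁ x) h1 h1,
    fun y => norm_tensorOp_le h1 (hn h₂ y) h1, fun z => norm_tensorOp_le h1 h1 (hn h₃ z),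
    fun x y z => ?_⟩
  simp only [← mul_apply_eq_comp, ← tensorOp_mul, one_mul, mul_one]
  have hre : ∀ a b c, P x y z a b c = (inner ℂ ψ (tensorOp (E₁ x a) (E₂ y b) (E₃ z c) ψ)).re :=
    fun a b c => by rw [← hP, Complex.ofReal_re]
  have hsub : ∀ a b : HilbertTensor₃ H₁ H₂ H₃,
      (inner ℂ ψ (a - b)).re = (inner ℂ ψ a).re - (inner ℂ ψ b).re := fun a b =>
    congrArg Complex.re (inner_sub_right ψ a b)
  simp only [correlation, hre, sum_sign, val_neg, val_one, tensorOp_sub_left, tensorOp_sub_middle,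
    tensorOp_sub_right, sub_apply, hsub]
  ring

open ContinuousLinearMap in
-- The operators of the first two parties move to the left of the inner product as adjoints, and `H`
-- is viewed as a real Hilbert space. This grouping `xy|z` serves Grothendieck's inequality; `x|yz`
-- below serves the Hadamard functional.
lemma exists_vectors_pair_first {γ : Table N} (hγ : γ ∈ Qcor N) :
    ∃ (H : Type) (_ : NormedAddCommGroup H) (_ : InnerProductSpace ℝ H) (_ : CompleteSpace H)
      (u : Fin N → Fin N → H) (v : Fin N → H), (∀ x y, ‖u x y‖ ≤ 1) ∧ (∀ z, ‖v z‖ ≤ 1) ∧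
      ∀ x y z, γ x y z = inner ℝ (u x y) (v z) := by
  obtain ⟨H, _, _, _, A, B, C, ψ, hψ, hA, hB, hC, h⟩ := exists_operators_of_mem_Qcor hγ
  have bound : ∀ (T : H →L[ℂ] H) (φ : H), ‖T‖ ≤ 1 → ‖φ‖ ≤ 1 → ‖T φ‖ ≤ 1 := fun T φ hT hφ =>
    (T.le_opNorm φ).trans (mul_le_one₀ hT (norm_nonneg _) hφ)
  refine ⟨H, inferInstance, InnerProductSpace.complexToReal, inferInstance,
    fun x y => adjoint (B y) (adjoint (A x) ψ), fun z => C z ψ, fun x y => ?_,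
    fun z => bound _ _ (hC z) hψ.le, fun x y z => ?_⟩
  · refine bound _ _ ?_ (bound _ _ ?_ hψ.le) <;> rw [LinearIsometryEquiv.norm_map]
    exacts [hB y, hA x]
  · rw [h, real_inner_eq_re_inner ℂ, adjoint_inner_left, adjoint_inner_left]
    rfl

open ContinuousLinearMap in
lemma exists_vectors_pair_second {γ : Table N} (hγ : γ ∈ Qcor N) :
    ∃ (H : Type) (_ : NormedAddCommGroup H) (_ : InnerProductSpace ℝ H) (_ : CompleteSpace H)
      (u : Fin N → H) (v : Fin N → Fin N → H), (∀ x, ‖u x‖ ≤ 1) ∧ (∀ y z, ‖v y z‖ ≤ 1) ∧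
      ∀ x y z, γ x y z = inner ℝ (u x) (v y z) := by
  obtain ⟨H, _, _, _, A, B, C, ψ, hψ, hA, hB, hC, h⟩ := exists_operators_of_mem_Qcor hγ
  have bound : ∀ (T : H →L[ℂ] H) (φ : H), ‖T‖ ≤ 1 → ‖φ‖ ≤ 1 → ‖T φ‖ ≤ 1 := fun T φ hT hφ =>
    (T.le_opNorm φ).trans (mul_le_one₀ hT (norm_nonneg _) hφ)
  refine ⟨H, inferInstance, InnerProductSpace.complexToReal, inferInstance,
    fun x => adjoint (A x) ψ, fun y z => B y (C z ψ), fun x => bound _ _ ?_ hψ.le,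
    fun y z => bound _ _ (hB y) (bound _ _ (hC z) hψ.le), fun x y z => ?_⟩
  · rw [LinearIsometryEquiv.norm_map]
    exact hA x
  · rw [h, real_inner_eq_re_inner ℂ, adjoint_inner_left]
    rfl

/-- Quantum values exceed bilocal values at most by the factor `K_G`. -/
lemma omega_Qcor_le (M : Table N) :
    omega (Qcor N) M ≤ ENNReal.ofReal grothendieckConstant * omega (BLcor N) M := by
  refine omega_le_ofReal_mul (one_pos.trans_le one_le_grothendieckConstant) fun hB γ hγ => ?_
  obtain ⟨H, _, _, _, u, v, hu, hv, h⟩ := exists_vectors_pair_first hγ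
  have hG := grothendieck_inequality (m := Fin N × Fin N) (n := Fin N)
    (M := fun p z => M p.1 p.2 z) (C := (omega (BLcor N) M).toReal) (fun a b => by
      have := abs_pairing_le_toReal hB (mem_BLcor (q := fun x y => val (a (x, y)))
        (r := fun z => val (b z)) (fun x y => (abs_val _).le) fun z => (abs_val _).le)
      simpa only [pairing, Fintype.sum_prod_type] using this)
    (u := fun p => u p.1 p.2) (v := v) (fun p => hu _ _) hv
  simpa only [pairing, Fintype.sum_prod_type, h] using hG

/-! ### Local correlations are dominated by quantum ones -/

/-- The measurement of a classical random outcome with expected values `r`. -/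
noncomputable def detMeasurement (r : Fin N → ℝ) (x : Fin N) (a : ℤˣ) : ℂ →L[ℂ] ℂ :=
  ((box₁ r x a : ℝ) : ℂ) • 1

lemma isMeasurement_detMeasurement {r : Fin N → ℝ} (hr : ∀ x, |r x| ≤ 1) :
    IsMeasurement (detMeasurement r) := by
  have h := isCondDist₁_box₁ hr
  refine ⟨fun x a => ContinuousLinearMap.isPositive_one.smul_of_nonneg ?_, fun x => ?_⟩
  · exact_mod_cast h.1 x a
  · simp only [detMeasurement, ← Finset.sum_smul]
    rw [← Complex.ofReal_sum, h.2, Complex.ofReal_one, one_smul]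

lemma inner_one_detMeasurement (r : Fin N → ℝ) (x : Fin N) (a : ℤˣ) :
    inner ℂ (1 : ℂ) (detMeasurement r x a 1) = ((box₁ r x a : ℝ) : ℂ) := by
  simp [detMeasurement]

/-- Classical randomness is a scalar POVM on `ℂ`, so one-dimensional spaces suffice. -/
lemma mem_Qcor {a b c : Fin N → ℝ} (ha : ∀ x, |a x| ≤ 1) (hb : ∀ y, |b y| ≤ 1)
    (hc : ∀ z, |c z| ≤ 1) : (fun x y z => a x * b y * c z : Table N) ∈ Qcor N := by
  refine ⟨fun x y z i j k => box₁ a x i * box₁ b y j * box₁ c z k,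
    ⟨ℂ, ℂ, ℂ, inferInstance, inferInstance, inferInstance, inferInstance, inferInstance,
      inferInstance, inferInstance, inferInstance, inferInstance, detMeasurement a,
      detMeasurement b, detMeasurement c, pureTensor 1 1 1,
      isMeasurement_detMeasurement ha, isMeasurement_detMeasurement hb,
      isMeasurement_detMeasurement hc, ?_, fun x y z i j k => ?_⟩, ?_⟩
  · rw [norm_pureTensor, norm_one, one_mul, one_mul]
  · rw [inner_tensorOp_pureTensor, inner_one_detMeasurement, inner_one_detMeasurement,
      inner_one_detMeasurement]
    push_cast
    ring
  · ext x y z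
    simp only [correlation, sum_sign, val_neg, val_one, box₁]
    ring

end Quantum

section LocalQuantum

variable {N : ℕ}

lemma abs_pairing_Lcor_le {M : Table N} {C : ℝ}
    (hM : ∀ a b c : Fin N → ℝ, (∀ x, |a x| ≤ 1) → (∀ y, |b y| ≤ 1) → (∀ z, |c z| ≤ 1) →
      |pairing M fun x y z => a x * b y * c z| ≤ C)
    {γ : Table N} (hγ : γ ∈ Lcor N) : |pairing M γ| ≤ C := by
  obtain ⟨P, ⟨n, p, P₁, P₂, P₃, hp, hp1, h₁, h₂, h₃, hP⟩, rfl⟩ := hγ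
  have h : correlation P = fun x y z =>
      ∑ l, p l * (corr₁ (P₁ l) x * corr₁ (P₂ l) y * corr₁ (P₃ l) z) := by
    ext x y z
    simp only [correlation, hP, sum_sign, corr₁, val_neg, val_one, Finset.mul_sum,
      ← Finset.sum_add_distrib]
    exact Finset.sum_congr rfl fun l _ => by ring
  rw [h]
  calc _ = |∑ l, p l * pairing M fun x y z =>
        corr₁ (P₁ l) x * corr₁ (P₂ l) y * corr₁ (P₃ l) z| := by
        refine congrArg abs ((pairing_sum M _).trans (Finset.sum_congr rfl fun l _ => ?_))
        simp only [pairing, Finset.mul_sum, mul_left_comm (p l)]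
    _ ≤ ∑ l, p l * C := by
        refine (Finset.abs_sum_le_sum_abs _ _).trans (Finset.sum_le_sum fun l _ => ?_)
        rw [abs_mul, abs_of_nonneg (hp l)]
        exact mul_le_mul_of_nonneg_left
          (hM _ _ _ (abs_corr₁_le (h₁ l)) (abs_corr₁_le (h₂ l)) (abs_corr₁_le (h₃ l))) (hp l)
    _ = C := by rw [← Finset.sum_mul, hp1, one_mul]

/-- Only product correlations have to be realised quantumly; mixtures are handled by convexity of
the absolute value, so no convexity of `Qcor` is needed. -/
lemma omega_Lcor_le (M : Table N) : omega (Lcor N) M ≤ omega (Qcor N) M := by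
  have := omega_le_ofReal_mul (A := Lcor N) (B := Qcor N) (M := M) one_pos fun hQ γ hγ => by
    rw [one_mul]
    exact abs_pairing_Lcor_le (fun a b c ha hb hc =>
      abs_pairing_le_toReal hQ (mem_Qcor ha hb hc)) hγ
  rwa [ENNReal.ofReal_one, one_mul] at this

end LocalQuantum

/-! ### Hadamard matrices -/

lemma exists_isHadamard (n : ℕ) : ∃ h : Matrix (Fin (2 ^ n)) (Fin (2 ^ n)) ℝ, h.IsHadamard := by
  induction n with
  | zero =>
    refine ⟨1, ?_, ?_, ?_⟩
    · intro i j
      have : i = j := Fin.ext (by lia)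
      rw [this, Matrix.one_apply_eq]
      exact one_mem _
    all_goals simp
  | succ n ih =>
    obtain ⟨h, hh⟩ := ih
    have h2 : (!![1, 1; 1, -1] : Matrix (Fin 2) (Fin 2) ℝ).IsHadamard := by
      refine ⟨fun i j => ?_, ?_, ?_⟩
      · fin_cases i <;> fin_cases j <;> simp [Unitary.mem_iff]
      all_goals
        ext i j
        fin_cases i <;> fin_cases j <;> norm_num [Matrix.mul_apply, Matrix.one_apply]
    -- Sylvester's construction: the Kronecker product with the Hadamard matrix of order `2`.
    have e : Fin (2 ^ n) × Fin 2 ≃ Fin (2 ^ (n + 1)) :=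
      finProdFinEquiv.trans (finCongr (pow_succ 2 n).symm)
    exact ⟨_, (hh.kronecker h2).reindex e e⟩

section Hadamard

variable {d : ℕ} {h : Matrix (Fin d) (Fin d) ℝ}

lemma isHadamard_mul_self (hh : h.IsHadamard) (i j : Fin d) : h i j * h i j = 1 := by
  simpa using (Unitary.mem_iff.mp (hh.apply_mem i j)).1

lemma isHadamard_sum_mul (hh : h.IsHadamard) (i j : Fin d) :
    ∑ k, h i k * h j k = if i = j then (d : ℝ) else 0 := by
  have := congrFun₂ hh.mul_conjTranspose i j
  simpa [Matrix.mul_apply, Matrix.one_apply] using this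

/-- The value of a Hadamard matrix as a bilinear form on unit vectors. -/
lemma isHadamard_vector_bound (hh : h.IsHadamard) {H : Type*} [NormedAddCommGroup H]
    [InnerProductSpace ℝ H] {u v : Fin d → H} (hu : ∀ i, ‖u i‖ ≤ 1) (hv : ∀ j, ‖v j‖ ≤ 1) :
    |∑ i, ∑ j, h i j * inner ℝ (u i) (v j)| ≤ d * √d := by
  set w : Fin d → H := fun j => ∑ i, h i j • u i with hw
  have hsq : ∑ j, ‖w j‖ ^ 2 ≤ (d : ℝ) ^ 2 := by
    -- Orthogonality of the rows removes the cross terms `i ≠ k`.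
    have e : ∑ j, ‖w j‖ ^ 2 = d * ∑ i, ‖u i‖ ^ 2 := by
      have e1 : ∀ j, ‖w j‖ ^ 2 = ∑ i, ∑ k, h i j * h k j * inner ℝ (u i) (u k) := fun j => by
        rw [← real_inner_self_eq_norm_sq, hw]
        simp only [sum_inner, inner_sum, real_inner_smul_left, real_inner_smul_right]
        exact Finset.sum_congr rfl fun i _ => Finset.sum_congr rfl fun k _ => by
          rw [real_inner_comm]
          ring
      simp only [e1]
      rw [Finset.sum_comm, Finset.mul_sum]
      refine Finset.sum_congr rfl fun i _ => ?_
      rw [Finset.sum_comm]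
      simp only [← Finset.sum_mul, isHadamard_sum_mul hh, ite_mul, zero_mul, Finset.sum_ite_eq,
        Finset.mem_univ, if_true, real_inner_self_eq_norm_sq]
    have e2 : ∑ i, ‖u i‖ ^ 2 ≤ (d : ℝ) := by
      refine (Finset.sum_le_card_nsmul _ _ 1 fun i _ =>
        pow_le_one₀ (norm_nonneg _) (hu i)).trans_eq ?_
      simp
    rw [e, pow_two]
    exact mul_le_mul_of_nonneg_left e2 (Nat.cast_nonneg d)
  have e : ∑ i, ∑ j, h i j * inner ℝ (u i) (v j) = ∑ j, inner ℝ (w j) (v j) := by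
    rw [Finset.sum_comm]
    simp only [hw, sum_inner, real_inner_smul_left]
  have hnorm : ∑ j, ‖w j‖ ≤ d * √d := by
    have h1 := sq_sum_le_card_mul_sum_sq (s := (Finset.univ : Finset (Fin d))) (f := fun j => ‖w j‖)
    rw [Finset.card_univ, Fintype.card_fin] at h1
    refine (pow_le_pow_iff_left₀ (Finset.sum_nonneg fun j _ => norm_nonneg _) (by positivity)
      two_ne_zero).mp (h1.trans ?_)
    rw [mul_pow, Real.sq_sqrt (Nat.cast_nonneg d), mul_comm]
    exact mul_le_mul_of_nonneg_right hsq (Nat.cast_nonneg d)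
  rw [e]
  refine (Finset.abs_sum_le_sum_abs _ _).trans (le_trans (Finset.sum_le_sum fun j _ => ?_) hnorm)
  exact (abs_real_inner_le_norm _ _).trans (mul_le_of_le_one_right (norm_nonneg _) (hv j))

lemma sum_eq_sum_castLE {N : ℕ} (hd : d ≤ N) {f : Fin N → ℝ}
    (hf : ∀ x : Fin N, ¬ (x : ℕ) < d → f x = 0) :
    ∑ x, f x = ∑ i, f (Fin.castLE hd i) := by
  obtain ⟨k, rfl⟩ := Nat.exists_eq_add_of_le hd
  rw [Fin.sum_univ_add, Finset.sum_eq_zero (s := Finset.univ (α := Fin k)), add_zero]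
  · rfl
  · exact fun i _ => hf _ (by simp)

lemma pairing_matrixFunctional {N : ℕ} (hd : d ≤ N) (hN : 0 < N) (γ : Table N) :
    pairing (matrixFunctional N h) γ =
      ∑ i, ∑ j, h i j * γ (Fin.castLE hd i) (Fin.castLE hd j) ⟨0, hN⟩ := by
  rw [pairing, sum_eq_sum_castLE hd fun x hx => by simp [matrixFunctional, hx]]
  refine Finset.sum_congr rfl fun i _ => ?_
  rw [sum_eq_sum_castLE hd fun x hx => by simp [matrixFunctional, hx]]
  refine Finset.sum_congr rfl fun j _ => ?_
  rw [Finset.sum_eq_single ⟨0, hN⟩]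
  · simp [matrixFunctional]
  · intro z _ hz
    have : (z : ℕ) ≠ 0 := fun h0 => hz (Fin.ext h0)
    simp [matrixFunctional, this]
  · simp

/-- The box may copy the signs of `h`, so each of the `d²` entries contributes `1`. -/
lemma le_omega_BLcor_matrixFunctional {N : ℕ} (hd : d ≤ N) (hN : 0 < N) (hh : h.IsHadamard) :
    ENNReal.ofReal ((d : ℝ) ^ 2) ≤ omega (BLcor N) (matrixFunctional N h) := by
  have hq : ∀ x y, |matrixFunctional N h x y ⟨0, hN⟩| ≤ 1 := fun x y => by
    unfold matrixFunctional
    split_ifs with hxy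
    · exact abs_le_one_iff_mul_self_le_one.mpr (isHadamard_mul_self hh _ _).le
    · simp
    · simp
  refine le_trans (le_of_eq ?_) (le_omega (mem_BLcor (r := fun _ => 1) hq (by simp)) _)
  rw [pairing_matrixFunctional hd hN]
  simp [matrixFunctional, isHadamard_mul_self hh, pow_two]

/-- Only one input `z` matters, so the grouping `x|yz` leaves a bilinear form in vectors indexed by
`x` and `y`. -/
lemma omega_Qcor_matrixFunctional_le {N : ℕ} (hd : d ≤ N) (hN : 0 < N) (hh : h.IsHadamard) :
    omega (Qcor N) (matrixFunctional N h) ≤ ENNReal.ofReal (d * √d) := by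
  refine iSup₂_le fun γ hγ => ENNReal.ofReal_le_ofReal ?_
  obtain ⟨H, _, _, _, u, v, hu, hv, hγ⟩ := exists_vectors_pair_second hγ
  rw [pairing_matrixFunctional hd hN]
  simp only [hγ]
  exact isHadamard_vector_bound hh (fun i => hu _) fun j => hv _ _

lemma le_omega_div_omega_matrixFunctional {N : ℕ} (hd : d ≤ N) (hN : 0 < N) (hNd : N < 2 * d)
    (hh : h.IsHadamard) :
    ENNReal.ofReal (√N / (4 * grothendieckConstant)) ≤
      omega (BLcor N) (matrixFunctional N h) / omega (Qcor N) (matrixFunctional N h) := by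
  have hd0 : (0 : ℝ) < d := by exact_mod_cast (by lia : 0 < d)
  have hs : 0 < √(d : ℝ) := Real.sqrt_pos.mpr hd0
  refine le_trans ?_ (ENNReal.div_le_div (le_omega_BLcor_matrixFunctional hd hN hh)
    (omega_Qcor_matrixFunctional_le hd hN hh))
  rw [← ENNReal.ofReal_div_of_pos (by positivity)]
  refine ENNReal.ofReal_le_ofReal ?_
  have e : (d : ℝ) ^ 2 / (d * √d) = √d := by
    rw [div_eq_iff (by positivity)]
    nlinarith [Real.mul_self_sqrt hd0.le]
  have hK := one_le_grothendieckConstant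
  -- Since `N < 2d`, the ratio `√d` has room to spare; `1 ≤ K_G` only weakens the bound.
  have hle : √(N : ℝ) ≤ 4 * √d := by
    rw [Real.sqrt_le_left (by positivity), mul_pow, Real.sq_sqrt hd0.le]
    have : (N : ℝ) ≤ 2 * d := by exact_mod_cast hNd.le
    linarith
  rw [e, div_le_iff₀ (by positivity)]
  nlinarith

end Hadamard

/-! ### Optimality of the order `√N` -/

lemma exists_hadamard_functional {N : ℕ} (hN : 1 ≤ N) :
    ∃ (n : ℕ) (h : Matrix (Fin (2 ^ n)) (Fin (2 ^ n)) ℝ),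
      2 ^ n ≤ N ∧ N < 2 * 2 ^ n ∧ h.IsHadamard ∧
      ENNReal.ofReal (√(N : ℝ) / (4 * grothendieckConstant)) ≤
        omega (BLcor N) (matrixFunctional N h) / omega (Qcor N) (matrixFunctional N h) := by
  -- The order is the largest power of two not exceeding `N`.
  obtain ⟨h, hh⟩ := exists_isHadamard (Nat.log 2 N)
  have h1 : 2 ^ Nat.log 2 N ≤ N := Nat.pow_log_le_self 2 (by lia)
  have h2 : N < 2 * 2 ^ Nat.log 2 N := by
    rw [← pow_succ']
    exact Nat.lt_pow_succ_log_self one_lt_two N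
  exact ⟨_, h, h1, h2, hh, le_omega_div_omega_matrixFunctional h1 hN h2 hh⟩

lemma le_LV_BLcor_Qcor (N : ℕ) :
    ENNReal.ofReal (√(N : ℝ) / (4 * grothendieckConstant)) ≤ LV (BLcor N) (Qcor N) := by
  rcases Nat.eq_zero_or_pos N with rfl | hN
  · simp
  · obtain ⟨n, h, -, -, -, hle⟩ := exists_hadamard_functional hN
    exact hle.trans (le_iSup (fun M => omega (BLcor N) M / omega (Qcor N) M) _)

lemma LV_BLcor_Qcor_le_LV_BLcor_Lcor (N : ℕ) : LV (BLcor N) (Qcor N) ≤ LV (BLcor N) (Lcor N) :=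
  iSup_mono fun M => ENNReal.div_le_div_left (omega_Lcor_le M) _

end BellCorrelation

theorem mainTheorem3 (N : ℕ) :
    -- the general and the non-signalling bilocal correlations coincide
    BellCorrelation.nsBLcor N = BellCorrelation.BLcor N ∧
    -- quantum over bilocal
    BellCorrelation.LV (BellCorrelation.Qcor N) (BellCorrelation.BLcor N) ≤
      ENNReal.ofReal BellCorrelation.grothendieckConstant ∧
    -- bilocal over local and over quantum: upper bounds
    BellCorrelation.LV (BellCorrelation.BLcor N) (BellCorrelation.Lcor N) ≤
      ENNReal.ofReal (Real.sqrt (2 * (N : ℝ))) ∧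
    BellCorrelation.LV (BellCorrelation.BLcor N) (BellCorrelation.Qcor N) ≤
      ENNReal.ofReal (Real.sqrt (2 * (N : ℝ))) ∧
    -- optimality of the order in both inequalities
    ENNReal.ofReal (Real.sqrt (N : ℝ) / (4 * BellCorrelation.grothendieckConstant)) ≤
      BellCorrelation.LV (BellCorrelation.BLcor N) (BellCorrelation.Qcor N) ∧
    ENNReal.ofReal (Real.sqrt (N : ℝ) / (4 * BellCorrelation.grothendieckConstant)) ≤
      BellCorrelation.LV (BellCorrelation.BLcor N) (BellCorrelation.Lcor N) ∧
    -- the lower bound is reached by a functional given by a Hadamard matrix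
    (1 ≤ N → ∃ (n : ℕ) (h : Matrix (Fin (2 ^ n)) (Fin (2 ^ n)) ℝ),
      2 ^ n ≤ N ∧ N < 2 * 2 ^ n ∧ h.IsHadamard ∧
      ENNReal.ofReal (Real.sqrt (N : ℝ) / (4 * BellCorrelation.grothendieckConstant)) ≤
        BellCorrelation.omega (BellCorrelation.BLcor N)
            (BellCorrelation.matrixFunctional N h) /
          BellCorrelation.omega (BellCorrelation.Qcor N)
            (BellCorrelation.matrixFunctional N h)) := by
  have hL := BellCorrelation.LV_le (BellCorrelation.omega_BLcor_le (N := N))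
  have hQ := BellCorrelation.le_LV_BLcor_Qcor N
  have hLQ := BellCorrelation.LV_BLcor_Qcor_le_LV_BLcor_Lcor N
  exact ⟨BellCorrelation.nsBLcor_eq_BLcor, BellCorrelation.LV_le BellCorrelation.omega_Qcor_le, hL,
    hLQ.trans hL, hQ, hQ.trans hLQ, BellCorrelation.exists_hadamard_functional⟩
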